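/- Let $n\ge 3$ and consider Minkowski spacetime $(\mathbb{R}^n,\eta_{ab})$, $\eta=\mathrm{diag}(-1,1,\dots,1)$, with $\square=\eta^{ab}\partial_a\partial_b$; indices are raised with $\eta$. A closed set $A\subseteq\mathbb{R}^n$ is past-compact if $A\cap J^-(p)$ is compact for every $p$; a smooth function or tensor field is past-compact if its support is. Write $C^\infty_{\mathrm{pc}}$ for the smooth past-compact functions; all fields below are smooth and past-compact. (a) There is exactly one retarded Green operator, i.e. one linear map $\mathsf{G}_{\mathrm{ret}}\colon C^\infty_{\mathrm{pc}}(\mathbb{R}^n)\to C^\infty_{\mathrm{pc}}(\mathbb{R}^n)$ with $\square\,\mathsf{G}_{\mathrm{ret}}f=f=\mathsf{G}_{\mathrm{ret}}\square f$ and $\mathrm{supp}(\mathsf{G}_{\mathrm{ret}}f)\subseteq J^+(\mathrm{supp} f)$ for all $f$. (b) Every symmetric past-compact $k_{ab}$ has a unique decomposition $$k_{ab}=\Big(\partial_a\partial_b-\tfrac1n\eta_{ab}\square\Big)w+\tfrac1n\eta_{ab}\,{k_c}^c+\big(\partial_av^{\mathrm T}_b+\partial_bv^{\mathrm T}_a\big)+k^{\mathrm{TT}}_{ab}$$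 with $w$, $v^{\mathrm T}_a$ and symmetric $k^{\mathrm{TT}}_{ab}$ smooth and past-compact, $\partial^av^{\mathrm T}_a=0$, $\partial^ak^{\mathrm{TT}}_{ab}=0$, $\eta^{ab}k^{\mathrm{TT}}_{ab}=0$. (c) (Complete gauge fixing) Let $h_{ab}$ be symmetric and past-compact, with trace-reversal $\bar h_{ab}=h_{ab}-\frac2n\eta_{ab}{h_c}^c$. There is exactly one past-compact covector field $\tilde X_a$ such that $$\partial^a\bar h'_{ab}=0,\qquad \bar h'_{ab}:=\bar h_{ab}+\partial_a\tilde X_b+\partial_b\tilde X_a-\tfrac4n\eta_{ab}\partial^c\tilde X_c .$$ If $\bar w,\bar v^{\mathrm T}_a$ are the scalar and vector components of $\bar h_{ab}$ from (b), and $\bar h={\bar h_c}{}^c$, then $\tilde X_a=\tilde X^{\mathrm T}_a+\partial_a\tilde Y$, where the unique past-compact pair $(\tilde X^{\mathrm T}_a,\tilde Y)$ with this property and $\partial^a\tilde X^{\mathrm T}_a=0$ is $$\tilde X^{\mathrm T}_a=-\bar v^{\mathrm T}_a,\qquad \tilde Y=-\mathsf{G}_{\mathrm{ret}}\Big(\tfrac{n-1}{2(n-2)}\square\bar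 w+\tfrac1{2(n-2)}\bar h\Big).$$ (d) The vector component $v^{\mathrm T}_a$ of $\bar h'_{ab}$ in (b), and hence its vector part $\partial_a v^{\mathrm T}_b+\partial_b v^{\mathrm T}_a$, vanishes. -/

import Mathlib

open scoped ContDiff

noncomputable section

namespace DeDonder

/-- Components of the Minkowski metric `diag(-1, 1, …, 1)` on `ℝⁿ`, the coordinate `0` being time.
The inverse metric has the same components. -/
def eta {n : ℕ} [NeZero n] (a b : Fin n) : ℝ :=
  if a = b then (if a = 0 then -1 else 1) else 0

/-- The causal past `J⁻(p)` of a point of Minkowski spacetime. -/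
def causalPast {n : ℕ} [NeZero n] (p : Fin n → ℝ) : Set (Fin n → ℝ) :=
  {q | q 0 ≤ p 0 ∧ ∑ a, ∑ b, eta a b * (p a - q a) * (p b - q b) ≤ 0}

/-- The causal future `J⁺(A)` of a subset of Minkowski spacetime. -/
def causalFuture {n : ℕ} [NeZero n] (A : Set (Fin n → ℝ)) : Set (Fin n → ℝ) :=
  {p | ∃ q ∈ A, q ∈ causalPast p}

/-- A (closed) set is past-compact if it meets the causal past of every point in a compact set. -/
def IsPastCompact {n : ℕ} [NeZero n] (A : Set (Fin n → ℝ)) : Prop :=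
  ∀ p, IsCompact (A ∩ causalPast p)

theorem isClosed_causalPast {n : ℕ} [NeZero n] (p : Fin n → ℝ) : IsClosed (causalPast p) := by
  have h1 : IsClosed {q : Fin n → ℝ | q 0 ≤ p 0} := isClosed_le (by fun_prop) (by fun_prop)
  have h2 : IsClosed {q : Fin n → ℝ |
      ∑ a, ∑ b, eta a b * (p a - q a) * (p b - q b) ≤ 0} :=
    isClosed_le (by fun_prop) (by fun_prop)
  exact h1.inter h2

theorem IsPastCompact.mono {n : ℕ} [NeZero n] {A B : Set (Fin n → ℝ)} (hB : IsPastCompact B)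
    (hA : IsClosed A) (h : A ⊆ B) : IsPastCompact A := fun p =>
  (hB p).of_isClosed_subset (hA.inter (isClosed_causalPast p)) (Set.inter_subset_inter_left _ h)

theorem IsPastCompact.union {n : ℕ} [NeZero n] {A B : Set (Fin n → ℝ)} (hA : IsPastCompact A)
    (hB : IsPastCompact B) : IsPastCompact (A ∪ B) := fun p => by
  rw [Set.union_inter_distrib_right]
  exact (hA p).union (hB p)

/-- `C^∞_pc(ℝⁿ)`: smooth real functions whose (closed) support is past-compact. -/
def pastCompactSmooth (n : ℕ) [NeZero n] : Submodule ℝ ((Fin n → ℝ) → ℝ) where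
  carrier := {f | ContDiff ℝ ∞ f ∧ IsPastCompact (tsupport f)}
  add_mem' := fun hf hg => ⟨hf.1.add hg.1,
    (hf.2.union hg.2).mono (isClosed_tsupport _) (tsupport_add _ _)⟩
  zero_mem' := ⟨contDiff_const, fun p => by simp [tsupport]⟩
  smul_mem' := fun c f hf => ⟨hf.1.const_smul c,
    hf.2.mono (isClosed_tsupport _)
      (closure_mono (Function.support_const_smul_subset c f))⟩

/-- Smooth past-compact scalar fields on `n`-dimensional Minkowski spacetime. -/
abbrev Scalar (n : ℕ) [NeZero n] : Type := ↥(pastCompactSmooth n)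

/-- Smooth past-compact covector fields `X_a`, given by their Cartesian components. -/
abbrev Covector (n : ℕ) [NeZero n] : Type := Fin n → Scalar n

/-- Smooth past-compact `(0,2)`-tensor fields `h_{ab}`, given by their Cartesian components. -/
abbrev Tensor2 (n : ℕ) [NeZero n] : Type := Fin n → Fin n → Scalar n

/-- The partial derivative `∂_a` on smooth past-compact functions. -/
def partialD {n : ℕ} [NeZero n] (a : Fin n) : Scalar n →ₗ[ℝ] Scalar n where
  toFun f := ⟨fun x => fderiv ℝ (f : (Fin n → ℝ) → ℝ) x (Pi.single a 1),
    (f.2.1.fderiv_right (m := ∞) (by norm_num)).clm_apply contDiff_const,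
    f.2.2.mono (isClosed_tsupport _) (tsupport_fderiv_apply_subset ℝ _)⟩
  map_add' f g := by
    ext x
    have hf := (f.2.1.differentiable (by simp)) x
    have hg := (g.2.1.differentiable (by simp)) x
    simp [fderiv_add hf hg]
  map_smul' c f := by
    ext x
    have hf := (f.2.1.differentiable (by simp)) x
    simp [fderiv_const_smul hf]

/-- The d'Alembertian `□ = η^{ab} ∂_a ∂_b`. -/
def dAlembert {n : ℕ} [NeZero n] : Scalar n →ₗ[ℝ] Scalar n :=
  ∑ a : Fin n, ∑ b : Fin n,
    (eta a b • ((partialD a).comp (partialD b)) : Scalar n →ₗ[ℝ] Scalar n)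

/-- The divergence `∂^a X_a`. -/
def div1 {n : ℕ} [NeZero n] (X : Covector n) : Scalar n :=
  ∑ a, ∑ c, eta a c • partialD c (X a)

/-- The divergence `∂^a h_{ab}`. -/
def div2 {n : ℕ} [NeZero n] (h : Tensor2 n) : Covector n := fun b =>
  ∑ a, ∑ c, eta a c • partialD c (h a b)

/-- The trace `η^{ab} h_{ab}`. -/
def trace {n : ℕ} [NeZero n] (h : Tensor2 n) : Scalar n :=
  ∑ a, ∑ b, eta a b • h a b

/-- Symmetry of a `(0,2)`-tensor field. -/
def IsSymm {n : ℕ} [NeZero n] (h : Tensor2 n) : Prop := ∀ a b, h a b = h b a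

/-- The trace-reversal `h_{ab} - (2/n) η_{ab} h_c^c`. -/
def traceReverse {n : ℕ} [NeZero n] (h : Tensor2 n) : Tensor2 n := fun a b =>
  h a b - (2 / (n : ℝ) * eta a b) • trace h

/-- The action of the gauge transformation `h_{ab} ↦ h_{ab} + ∂_a X_b + ∂_b X_a` on the
trace-reversed perturbation:
`hbar_{ab} + ∂_a X_b + ∂_b X_a - (4/n) η_{ab} ∂^c X_c`. -/
def gaugeTraceReverse {n : ℕ} [NeZero n] (h : Tensor2 n) (X : Covector n) : Tensor2 n :=
  fun a b => traceReverse h a b + partialD a (X b) + partialD b (X a)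
    - (4 / (n : ℝ) * eta a b) • div1 X

/-- The scalar part `(∂_a ∂_b - (1/n) η_{ab} □) w + (1/n) η_{ab} k_c^c` of `k`. -/
def scalarPart {n : ℕ} [NeZero n] (k : Tensor2 n) (w : Scalar n) : Tensor2 n := fun a b =>
  partialD a (partialD b w) - (1 / (n : ℝ) * eta a b) • dAlembert w
    + (1 / (n : ℝ) * eta a b) • trace k

/-- The vector part `∂_a v_b + ∂_b v_a`. -/
def vectorPart {n : ℕ} [NeZero n] (v : Covector n) : Tensor2 n := fun a b =>
  partialD a (v b) + partialD b (v a)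

/-- `(w, v, t)` are the components of the decomposition of the symmetric tensor field `k` into a
scalar, a vector, and a transverse-traceless part. -/
structure IsDecomposition {n : ℕ} [NeZero n] (k : Tensor2 n)
    (w : Scalar n) (v : Covector n) (t : Tensor2 n) : Prop where
  vector_transverse : div1 v = 0
  tensor_symm : IsSymm t
  tensor_transverse : div2 t = 0
  tensor_traceless : trace t = 0
  eq_sum : k = scalarPart k w + vectorPart v + t

/-- `(XT, Y)` decompose `X` into a transverse and a longitudinal part: `X_a = XT_a + ∂_a Y` with
`∂^a XT_a = 0`. -/
structure IsTransverseLongitudinal {n : ℕ} [NeZero n] (X XT : Covector n) (Y : Scalar n) : Prop where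
  transverse : div1 XT = 0
  eq_sum : ∀ a, X a = XT a + partialD a Y

/-- `G` is a retarded Green operator of the d'Alembertian on `C^∞_pc(ℝⁿ)`. -/
structure IsRetardedGreen {n : ℕ} [NeZero n] (G : Scalar n →ₗ[ℝ] Scalar n) : Prop where
  dAlembert_comp : ∀ f, dAlembert (G f) = f
  comp_dAlembert : ∀ f, G (dAlembert f) = f
  support : ∀ f : Scalar n, tsupport (G f : (Fin n → ℝ) → ℝ) ⊆
    causalFuture (tsupport (f : (Fin n → ℝ) → ℝ))

end DeDonder

end

noncomputable section

namespace DeDonder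

variable {n : ℕ} [NeZero n]

section GreenOperator

open MeasureTheory Set Filter Topology
open scoped Convolution FourierTransform Pointwise

/-! ### Minkowski form and forward cone -/

/-! Everything rests on inverting □ on past-compact functions; the tensor statements are then linear
algebra over that inverse. The inverse comes from M. Riesz's kernel. The locally bounded function
`rieszKernel`, homogeneous of degree `n` and Lorentz invariant, has Laplace transform proportional
to `minkowski ζ ζ` to the power `-n`: a boost and a dilation reduce every timelike ζ to the unit
time covector (`laplace_rieszKernel`), and analytic continuation reaches ζ = (1, 0, …, 0) + iξ
(`laplace_rieszKernel_complex`). Fourier uniqueness shows that convolution with it undoes □ⁿ on test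
functions, up to a nonzero constant (`riesz_convolution_dAlembert_pow`). Using the power `n` keeps
the kernel a function, where the kernel of □⁻¹ itself is in general only a distribution. Since the
kernel lives on the forward cone, the convolution at a point sees only its causal past, where a
past-compact function agrees with a test function, so the identity extends. Composing with □ⁿ⁻¹
gives `retardedGreen`. For the tensors, the double divergence of `k` together with its trace fixes
□□w, and then the divergence of `k` fixes □v. The gauge condition is treated likewise: its
divergence fixes □ of the divergence of `X`, with coefficient 2 - 4/n, nonzero for n ≥ 3. -/

theorem eta_zero_zero : eta (0 : Fin n) 0 = -1 := by simp [eta]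

theorem eta_self_of_ne {a : Fin n} (h : a ≠ 0) : eta a a = 1 := by simp [eta, h]

theorem eta_mul_self (a : Fin n) : eta a a * eta a a = 1 := by
  by_cases h : a = 0 <;> simp [eta, h]

theorem sum_eta_smul {M : Type*} [AddCommGroup M] [Module ℝ M] (a : Fin n) (F : Fin n → M) :
    ∑ b, eta a b • F b = eta a a • F a := by
  rw [Finset.sum_eq_single a (fun b _ hb => by simp [eta, Ne.symm hb]) (by simp)]

/-- The Minkowski inner product of two vectors. -/
def minkowski : (Fin n → ℝ) →ₗ[ℝ] (Fin n → ℝ) →ₗ[ℝ] ℝ :=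
  LinearMap.mk₂ ℝ (fun x y => ∑ a, eta a a * x a * y a)
    (fun x y z => by simp only [Pi.add_apply, ← Finset.sum_add_distrib]; congr! 1; ring)
    (fun c x y => by
      simp only [Pi.smul_apply, smul_eq_mul, Finset.mul_sum]; congr! 1; ring)
    (fun x y z => by simp only [Pi.add_apply, ← Finset.sum_add_distrib]; congr! 1; ring)
    (fun c x y => by
      simp only [Pi.smul_apply, smul_eq_mul, Finset.mul_sum]; congr! 1; ring)

theorem minkowski_apply (x y : Fin n → ℝ) : minkowski x y = ∑ a, eta a a * x a * y a := rfl

theorem minkowski_comm (x y : Fin n → ℝ) : minkowski x y = minkowski y x := by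
  simp only [minkowski_apply]; congr! 1; ring

theorem minkowski_eq (x y : Fin n → ℝ) :
    minkowski x y = - (x 0 * y 0) + ∑ a ∈ Finset.univ.erase 0, x a * y a := by
  rw [minkowski_apply, ← Finset.add_sum_erase _ _ (Finset.mem_univ 0), eta_zero_zero]
  congr 1
  · ring
  · refine Finset.sum_congr rfl fun a ha => ?_
    rw [eta_self_of_ne (Finset.ne_of_mem_erase ha), one_mul]

theorem minkowski_single_zero (y : Fin n → ℝ) : minkowski (Pi.single 0 1) y = - y 0 := by
  rw [minkowski_eq, Finset.sum_eq_zero]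
  · simp
  · intro a ha
    simp [Finset.ne_of_mem_erase ha]

theorem continuous_minkowski_self : Continuous fun x : Fin n → ℝ => minkowski x x := by
  simp only [minkowski_apply]
  fun_prop

/-- The closed forward light cone. -/
def forwardCone (n : ℕ) [NeZero n] : Set (Fin n → ℝ) := {x | 0 ≤ x 0 ∧ minkowski x x ≤ 0}

theorem mem_causalPast_iff {p q : Fin n → ℝ} : q ∈ causalPast p ↔ p - q ∈ forwardCone n := by
  have h : ∑ a, ∑ b, eta a b * (p a - q a) * (p b - q b) = minkowski (p - q) (p - q) := by
    rw [minkowski_apply]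
    refine Finset.sum_congr rfl fun a _ => ?_
    rw [Finset.sum_eq_single a (fun b _ hb => by simp [eta, Ne.symm hb]) (by simp)]
    rfl
  simp [causalPast, forwardCone, h]

theorem isClosed_forwardCone : IsClosed (forwardCone n) := by
  have h : IsClosed {x : Fin n → ℝ | 0 ≤ x 0} := isClosed_le continuous_const (by fun_prop)
  exact h.inter (isClosed_le continuous_minkowski_self continuous_const)

theorem sum_sq_le_of_mem_forwardCone {x : Fin n → ℝ} (hx : x ∈ forwardCone n) :
    ∑ a ∈ Finset.univ.erase 0, x a ^ 2 ≤ x 0 ^ 2 := by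
  have := hx.2
  rw [minkowski_eq] at this
  simp only [← sq] at this
  linarith

theorem abs_apply_le_of_mem_forwardCone {x : Fin n → ℝ} (hx : x ∈ forwardCone n) (a : Fin n) :
    |x a| ≤ x 0 := by
  by_cases h : a = 0
  · rw [h, abs_of_nonneg hx.1]
  · refine abs_le_of_sq_le_sq ?_ hx.1
    exact (Finset.single_le_sum (f := fun a => x a ^ 2) (fun i _ => sq_nonneg _)
      (Finset.mem_erase.2 ⟨h, Finset.mem_univ a⟩)).trans (sum_sq_le_of_mem_forwardCone hx)

/-- Cauchy–Schwarz on the spatial components. It makes the cone closed under addition, hence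
causality transitive, and makes boosts preserve time orientation. -/
theorem minkowski_nonpos {x y : Fin n → ℝ} (hx : x ∈ forwardCone n) (hy : y ∈ forwardCone n) :
    minkowski x y ≤ 0 := by
  have h : |∑ a ∈ Finset.univ.erase 0, x a * y a| ≤ x 0 * y 0 := by
    refine abs_le_of_sq_le_sq ?_ (mul_nonneg hx.1 hy.1)
    refine (Finset.sum_mul_sq_le_sq_mul_sq _ _ _).trans ?_
    rw [mul_pow]
    exact mul_le_mul (sum_sq_le_of_mem_forwardCone hx) (sum_sq_le_of_mem_forwardCone hy)
      (Finset.sum_nonneg fun _ _ => sq_nonneg _) (sq_nonneg _)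
  rw [minkowski_eq]
  linarith [le_abs_self (∑ a ∈ Finset.univ.erase 0, x a * y a)]

theorem add_mem_forwardCone {x y : Fin n → ℝ} (hx : x ∈ forwardCone n) (hy : y ∈ forwardCone n) :
    x + y ∈ forwardCone n := by
  refine ⟨add_nonneg hx.1 hy.1, ?_⟩
  simp only [map_add, LinearMap.add_apply]
  linarith [hx.2, hy.2, minkowski_nonpos hx hy, minkowski_nonpos hy hx]

theorem zero_mem_forwardCone : (0 : Fin n → ℝ) ∈ forwardCone n := by
  simp [forwardCone]

theorem smul_mem_forwardCone_iff {c : ℝ} (hc : 0 < c) {x : Fin n → ℝ} :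
    c • x ∈ forwardCone n ↔ x ∈ forwardCone n := by
  simp only [forwardCone, mem_ofPred_eq, map_smul, LinearMap.smul_apply, Pi.smul_apply,
    smul_eq_mul, mul_nonneg_iff_of_pos_left hc]
  rw [← mul_assoc, mul_nonpos_iff_pos_imp_nonpos]
  simp [hc, mul_pos hc hc]
  grind

/-! ### Boosts -/

/-- An involutive Lorentz transformation exchanging the unit time vector and `u`. -/
def boost (u : Fin n → ℝ) : (Fin n → ℝ) →ₗ[ℝ] (Fin n → ℝ) :=
  -LinearMap.id - ((1 + u 0)⁻¹ • (minkowski (Pi.single 0 1 + u))).smulRight (Pi.single 0 1 + u)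

theorem boost_apply (u x : Fin n → ℝ) : boost u x =
    -x - ((1 + u 0)⁻¹ * minkowski (Pi.single 0 1 + u) x) • (Pi.single 0 1 + u) := rfl

/-- This value identifies `boost u` as minus the reflection in the hyperplane orthogonal to
`Pi.single 0 1 + u`, so it is an involutive isometry. -/
theorem minkowski_single_add_self {u : Fin n → ℝ} (hu : minkowski u u = -1) :
    minkowski (Pi.single 0 1 + u) (Pi.single 0 1 + u) = -2 * (1 + u 0) := by
  simp only [map_add, LinearMap.add_apply, minkowski_single_zero, hu,
    minkowski_comm u (Pi.single 0 1), Pi.single_eq_same]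
  ring

theorem minkowski_boost_boost {u : Fin n → ℝ} (hu : minkowski u u = -1) (hu0 : 0 < u 0)
    (x y : Fin n → ℝ) :
    minkowski (boost u x) (boost u y) = minkowski x y := by
  have h : 1 + u 0 ≠ 0 := by positivity
  have hw := minkowski_single_add_self hu
  simp only [boost_apply]
  generalize Pi.single 0 1 + u = w at *
  simp only [map_sub, map_neg, map_smul, LinearMap.sub_apply, LinearMap.neg_apply,
    LinearMap.smul_apply, smul_eq_mul, hw, minkowski_comm x w]
  field_simp
  ring

theorem boost_boost {u : Fin n → ℝ} (hu : minkowski u u = -1) (hu0 : 0 < u 0)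
    (x : Fin n → ℝ) : boost u (boost u x) = x := by
  have h : 1 + u 0 ≠ 0 := by positivity
  have hw := minkowski_single_add_self hu
  simp only [boost_apply]
  generalize Pi.single 0 1 + u = w at *
  simp only [map_sub, map_neg, map_smul, smul_eq_mul, hw]
  ext a
  simp only [Pi.sub_apply, Pi.neg_apply, Pi.smul_apply, smul_eq_mul]
  field_simp
  ring

theorem boost_single_zero {u : Fin n → ℝ} (hu0 : 0 < u 0) : boost u (Pi.single 0 1) = u := by
  have h : 1 + u 0 ≠ 0 := by positivity
  rw [boost_apply, minkowski_comm, minkowski_single_zero]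
  have : (1 + u 0)⁻¹ * -(Pi.single 0 1 + u : Fin n → ℝ) 0 = -1 := by
    simp
    field_simp
    ring
  rw [this]
  module

theorem minkowski_boost {u : Fin n → ℝ} (hu : minkowski u u = -1) (hu0 : 0 < u 0)
    (x : Fin n → ℝ) : minkowski u (boost u x) = - x 0 := by
  conv_lhs => arg 1; rw [← boost_single_zero hu0]
  rw [minkowski_boost_boost hu hu0, minkowski_single_zero]

/-- The time component of the image is minus the product of `u` with `x`, which is nonnegative
because both lie in the forward cone. -/
theorem boost_mem_forwardCone {u : Fin n → ℝ} (hu : minkowski u u = -1) (hu0 : 0 < u 0)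
    {x : Fin n → ℝ} (hx : x ∈ forwardCone n) :
    boost u x ∈ forwardCone n := by
  refine ⟨?_, by rw [minkowski_boost_boost hu hu0]; exact hx.2⟩
  have h2 : minkowski (boost u (Pi.single 0 1)) (boost u (boost u x)) ≤ 0 := by
    rw [boost_boost hu hu0, boost_single_zero hu0]
    exact minkowski_nonpos ⟨hu0.le, by rw [hu]; norm_num⟩ hx
  rw [minkowski_boost_boost hu hu0, minkowski_single_zero] at h2
  linarith

theorem boost_mem_forwardCone_iff {u : Fin n → ℝ} (hu : minkowski u u = -1) (hu0 : 0 < u 0)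
    {x : Fin n → ℝ} :
    boost u x ∈ forwardCone n ↔ x ∈ forwardCone n :=
  ⟨fun h => by simpa [boost_boost hu hu0] using boost_mem_forwardCone hu hu0 h,
    boost_mem_forwardCone hu hu0⟩

theorem abs_det_boost {u : Fin n → ℝ} (hu : minkowski u u = -1) (hu0 : 0 < u 0) :
    |(boost u).det| = 1 := by
  have h : (boost u).comp (boost u) = LinearMap.id :=
    LinearMap.ext fun x => boost_boost hu hu0 x
  have h2 := congrArg LinearMap.det h
  rw [LinearMap.det_comp, LinearMap.det_id] at h2
  have h3 : |(boost u).det| * |(boost u).det| = 1 := by rw [← abs_mul, h2, abs_one]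
  nlinarith [abs_nonneg (boost u).det]

/-! ### The Riesz kernel -/

/-- The (unnormalised) Riesz kernel: the `n`-th power of Lorentzian distance on the forward cone. -/
def rieszKernel (x : Fin n → ℝ) : ℝ :=
  (forwardCone n).indicator (fun x => √(-minkowski x x) ^ n) x

theorem rieszKernel_nonneg (x : Fin n → ℝ) : 0 ≤ rieszKernel x :=
  indicator_nonneg (fun _ _ => by positivity) x

theorem rieszKernel_of_mem {x : Fin n → ℝ} (hx : x ∈ forwardCone n) :
    rieszKernel x = √(-minkowski x x) ^ n := indicator_of_mem hx _

theorem rieszKernel_of_notMem {x : Fin n → ℝ} (hx : x ∉ forwardCone n) :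
    rieszKernel x = 0 := indicator_of_notMem hx _

theorem measurable_rieszKernel : Measurable (rieszKernel (n := n)) := by
  refine Measurable.indicator ?_ isClosed_forwardCone.measurableSet
  exact (continuous_minkowski_self.neg.sqrt.pow n).measurable

theorem rieszKernel_le {x : Fin n → ℝ} (hx : x ∈ forwardCone n) : rieszKernel x ≤ x 0 ^ n := by
  rw [rieszKernel_of_mem hx]
  refine pow_le_pow_left₀ (Real.sqrt_nonneg _) (Real.sqrt_le_iff.2 ⟨hx.1, ?_⟩) _
  rw [minkowski_eq]
  have : 0 ≤ ∑ a ∈ Finset.univ.erase 0, x a * x a :=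
    Finset.sum_nonneg fun _ _ => mul_self_nonneg _
  nlinarith

theorem rieszKernel_smul {c : ℝ} (hc : 0 < c) (x : Fin n → ℝ) :
    rieszKernel (c • x) = c ^ n * rieszKernel x := by
  by_cases hx : x ∈ forwardCone n
  · rw [rieszKernel_of_mem hx, rieszKernel_of_mem ((smul_mem_forwardCone_iff hc).2 hx), ← mul_pow]
    congr 1
    simp only [map_smul, LinearMap.smul_apply, smul_eq_mul]
    rw [show -(c * (c * minkowski x x)) = c ^ 2 * -minkowski x x by ring,
      Real.sqrt_mul (sq_nonneg c), Real.sqrt_sq hc.le]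
  · rw [rieszKernel_of_notMem hx, rieszKernel_of_notMem (mt (smul_mem_forwardCone_iff hc).1 hx),
      mul_zero]

theorem rieszKernel_boost {u : Fin n → ℝ} (hu : minkowski u u = -1) (hu0 : 0 < u 0)
    (x : Fin n → ℝ) : rieszKernel (boost u x) = rieszKernel x := by
  by_cases hx : x ∈ forwardCone n
  · rw [rieszKernel_of_mem hx, rieszKernel_of_mem ((boost_mem_forwardCone_iff hu hu0).2 hx),
      minkowski_boost_boost hu hu0]
  · rw [rieszKernel_of_notMem hx, rieszKernel_of_notMem (mt (boost_mem_forwardCone_iff hu hu0).1 hx)]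

theorem locallyIntegrable_rieszKernel : LocallyIntegrable (rieszKernel (n := n)) := by
  have h : LocallyIntegrable (fun x : Fin n → ℝ => x 0 ^ n) :=
    (by fun_prop : Continuous fun x : Fin n → ℝ => x 0 ^ n).locallyIntegrable
  refine h.mono measurable_rieszKernel.aestronglyMeasurable (ae_of_all _ fun x => ?_)
  rw [Real.norm_of_nonneg (rieszKernel_nonneg x)]
  by_cases hx : x ∈ forwardCone n
  · exact (rieszKernel_le hx).trans (le_abs_self _)
  · rw [rieszKernel_of_notMem hx]; positivity

theorem integrable_exp_neg_mul_abs {c : ℝ} (hc : 0 < c) :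
    Integrable fun x : ℝ => Real.exp (-(c * |x|)) := by
  have h1 : IntegrableOn (fun x : ℝ => Real.exp (-(c * |x|))) (Ioi 0) := by
    refine (integrableOn_exp_mul_Ioi (neg_neg_of_pos hc) 0).congr_fun (fun x hx => ?_)
      measurableSet_Ioi
    simp [abs_of_pos (mem_Ioi.1 hx)]
  have h2 : IntegrableOn (fun x : ℝ => Real.exp (-(c * |x|))) (Iic 0) := by
    refine (integrableOn_exp_mul_Iic hc 0).congr_fun (fun x hx => ?_) measurableSet_Iic
    simp [abs_of_nonpos (mem_Iic.1 hx)]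
  have := h2.union h1
  rwa [Iic_union_Ioi, integrableOn_univ] at this

/-- On the cone every coordinate is bounded by `x 0`. Half of the decay absorbs the growth `x 0 ^
n`; the other half, split evenly over the `n` coordinates, is dominated by a product of
one-dimensional integrable exponentials. -/
theorem integrable_rieszKernel_mul_exp {c : ℝ} (hc : 0 < c) :
    Integrable fun x : Fin n → ℝ => rieszKernel x * Real.exp (-(c * x 0)) := by
  have hn : (0 : ℝ) < n := by exact_mod_cast Nat.pos_of_ne_zero (NeZero.ne n)
  have hb : Integrable fun x : Fin n → ℝ =>
      (n.factorial / (c / 2) ^ n) * ∏ a, Real.exp (-(c / (2 * n) * |x a|)) :=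
    (Integrable.fintype_prod fun _ => integrable_exp_neg_mul_abs (by positivity)).const_mul _
  refine hb.mono' (measurable_rieszKernel.mul (by fun_prop)).aestronglyMeasurable
    (ae_of_all _ fun x => ?_)
  rw [Real.norm_of_nonneg (mul_nonneg (rieszKernel_nonneg x) (Real.exp_pos _).le)]
  by_cases hx : x ∈ forwardCone n
  · have h1 : (c / 2 * x 0) ^ n / n.factorial ≤ Real.exp (c / 2 * x 0) :=
      Real.pow_div_factorial_le_exp _ (mul_nonneg (by positivity) hx.1) n
    have h2 : rieszKernel x ≤ n.factorial / (c / 2) ^ n * Real.exp (c / 2 * x 0) := by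
      refine (rieszKernel_le hx).trans ?_
      rw [mul_pow, div_le_iff₀ (by positivity)] at h1
      rw [div_mul_eq_mul_div, le_div_iff₀ (by positivity)]
      linarith
    have h3 : Real.exp (-(c / 2 * x 0)) ≤ ∏ a, Real.exp (-(c / (2 * n) * |x a|)) := by
      rw [← Real.exp_sum, Real.exp_le_exp, Finset.sum_neg_distrib, ← Finset.mul_sum, neg_le_neg_iff]
      have : ∑ a, |x a| ≤ n * x 0 := by
        simpa using Finset.sum_le_card_nsmul Finset.univ (fun a => |x a|) (x 0)
          fun a _ => abs_apply_le_of_mem_forwardCone hx a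
      calc c / (2 * n) * ∑ a, |x a| ≤ c / (2 * n) * (n * x 0) := by gcongr
        _ = c / 2 * x 0 := by field_simp
    calc rieszKernel x * Real.exp (-(c * x 0))
        ≤ n.factorial / (c / 2) ^ n * Real.exp (c / 2 * x 0) * Real.exp (-(c * x 0)) := by gcongr
      _ = n.factorial / (c / 2) ^ n * Real.exp (-(c / 2 * x 0)) := by
        rw [mul_assoc, ← Real.exp_add]; ring_nf
      _ ≤ _ := by gcongr
  · rw [rieszKernel_of_notMem hx, zero_mul]
    positivity

theorem integral_rieszKernel_pos :
    0 < ∫ x : Fin n → ℝ, rieszKernel x * Real.exp (-x 0) := by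
  have hi : Integrable fun x : Fin n → ℝ => rieszKernel x * Real.exp (-x 0) := by
    simpa using integrable_rieszKernel_mul_exp (n := n) one_pos
  rw [integral_pos_iff_support_of_nonneg
    (fun x => mul_nonneg (rieszKernel_nonneg x) (Real.exp_pos _).le) hi]
  have h0 : IsOpen {x : Fin n → ℝ | 0 < x 0} := isOpen_lt continuous_const (by fun_prop)
  have ho : IsOpen {x : Fin n → ℝ | 0 < x 0 ∧ minkowski x x < 0} :=
    h0.inter (isOpen_lt continuous_minkowski_self continuous_const)
  refine (ho.measure_pos volume ⟨Pi.single 0 1, by simp [minkowski_single_zero]⟩).trans_le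
    (measure_mono fun x hx => ?_)
  have hx' : x ∈ forwardCone n := ⟨hx.1.le, hx.2.le⟩
  rw [Function.mem_support, rieszKernel_of_mem hx']
  have := Real.sqrt_pos.2 (neg_pos.2 hx.2)
  positivity

/-! ### The Laplace transform of the Riesz kernel -/

theorem integral_comp_boost {u : Fin n → ℝ} (hu : minkowski u u = -1) (hu0 : 0 < u 0)
    {g : (Fin n → ℝ) → ℝ} (hg : Measurable g) : ∫ x, g (boost u x) = ∫ x, g x := by
  have hd := abs_det_boost hu hu0
  have hd0 : (boost u).det ≠ 0 := fun h => by simp [h] at hd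
  have hm := Measure.map_linearMap_addHaar_eq_smul_addHaar (volume : Measure (Fin n → ℝ)) hd0
  rw [abs_inv, hd, inv_one, ENNReal.ofReal_one, one_smul] at hm
  rw [← integral_map (φ := boost u)
    (LinearMap.continuous_of_finiteDimensional (boost u)).aemeasurable
    hg.aestronglyMeasurable, hm]

/-- With ρ the Lorentzian length of ζ, a boost turns the exponent into -ρ `x 0`. Rescaling by ρ then
costs ρ⁻ⁿ from the kernel and ρ⁻ⁿ from the volume. -/
theorem laplace_rieszKernel {ζ : Fin n → ℝ} (h0 : 0 < ζ 0) (h : minkowski ζ ζ < 0) :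
    (∫ x, rieszKernel x * Real.exp (-∑ a, ζ a * x a)) * minkowski ζ ζ ^ n =
      (-1) ^ n * ∫ x : Fin n → ℝ, rieszKernel x * Real.exp (-x 0) := by
  obtain ⟨ρ, hρ, hρ2⟩ : ∃ ρ : ℝ, 0 < ρ ∧ minkowski ζ ζ = -ρ ^ 2 :=
    ⟨√(-minkowski ζ ζ), Real.sqrt_pos.2 (by linarith), by rw [Real.sq_sqrt (by linarith)]; ring⟩
  -- Raising the index of ζ flips its time component; the minus sign makes `u` future-directed.
  set u : Fin n → ℝ := fun a => -(ρ⁻¹ * (eta a a * ζ a)) with hu_def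
  have hu (x : Fin n → ℝ) : ∑ a, ζ a * x a = -ρ * minkowski u x := by
    rw [minkowski_apply, Finset.mul_sum]
    refine Finset.sum_congr rfl fun a _ => ?_
    have h1 := eta_mul_self a
    simp only [hu_def]
    field_simp
    linear_combination (-ζ a * x a) * h1
  have huu : minkowski u u = -1 := by
    have h2 : minkowski u u = ρ⁻¹ ^ 2 * minkowski ζ ζ := by
      rw [minkowski_apply, minkowski_apply, Finset.mul_sum]
      refine Finset.sum_congr rfl fun a _ => ?_
      simp only [hu_def]
      linear_combination (ρ⁻¹ ^ 2 * eta a a * ζ a * ζ a) * eta_mul_self a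
    rw [h2, hρ2]
    field_simp
  have hu0 : 0 < u 0 := by
    simp only [hu_def, eta_zero_zero]
    have : 0 < ρ⁻¹ * ζ 0 := by positivity
    linarith
  have hρn : ρ ^ n ≠ 0 := by positivity
  rw [← integral_comp_boost huu hu0 (g := fun x => rieszKernel x * Real.exp (-∑ a, ζ a * x a))
    (measurable_rieszKernel.mul (by fun_prop))]
  have h3 (x : Fin n → ℝ) : rieszKernel (boost u x) * Real.exp (-∑ a, ζ a * boost u x a) =
      (ρ ^ n)⁻¹ * (rieszKernel (ρ • x) * Real.exp (-(ρ • x) 0)) := by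
    rw [hu, minkowski_boost huu hu0, rieszKernel_boost huu hu0, rieszKernel_smul hρ]
    simp only [Pi.smul_apply, smul_eq_mul]
    field_simp
  simp_rw [h3]
  rw [integral_const_mul, Measure.integral_comp_smul volume
    (fun x : Fin n → ℝ => rieszKernel x * Real.exp (-x 0)), hρ2, Module.finrank_fin_fun,
    abs_of_nonneg (by positivity), smul_eq_mul, neg_pow (ρ ^ 2), ← pow_mul, mul_comm 2, pow_mul]
  field_simp

/-- The measure with density `rieszKernel x * exp (-x 0)`. -/
def rieszMeasure (n : ℕ) [NeZero n] : Measure (Fin n → ℝ) :=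
  volume.withDensity fun x => ENNReal.ofReal (rieszKernel x * Real.exp (-x 0))

theorem measurable_rieszDensity :
    Measurable fun x : Fin n → ℝ => ENNReal.ofReal (rieszKernel x * Real.exp (-x 0)) :=
  (measurable_rieszKernel.mul (by fun_prop)).ennreal_ofReal

theorem toReal_rieszDensity (x : Fin n → ℝ) :
    (ENNReal.ofReal (rieszKernel x * Real.exp (-x 0))).toReal = rieszKernel x * Real.exp (-x 0) :=
  ENNReal.toReal_ofReal (mul_nonneg (rieszKernel_nonneg x) (Real.exp_pos _).le)

theorem integral_rieszMeasure {E : Type*} [NormedAddCommGroup E] [NormedSpace ℝ E]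
    (g : (Fin n → ℝ) → E) :
    ∫ x, g x ∂(rieszMeasure n) = ∫ x, (rieszKernel x * Real.exp (-x 0)) • g x := by
  rw [rieszMeasure, integral_withDensity_eq_integral_toReal_smul measurable_rieszDensity
    (ae_of_all _ fun _ => ENNReal.ofReal_lt_top)]
  simp_rw [toReal_rieszDensity]

theorem integrable_rieszMeasure_iff {E : Type*} [NormedAddCommGroup E] [NormedSpace ℝ E]
    {g : (Fin n → ℝ) → E} :
    Integrable g (rieszMeasure n) ↔
      Integrable fun x => (rieszKernel x * Real.exp (-x 0)) • g x := by
  rw [rieszMeasure, integrable_withDensity_iff_integrable_smul' measurable_rieszDensity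
    (ae_of_all _ fun _ => ENNReal.ofReal_lt_top)]
  simp_rw [toReal_rieszDensity]

/-- The factor `exp (-x 0)` in the measure pays for the tilt by `s`, leaving decay at rate 1 - |s| ∑
|ξ a|. Hence the moment generating function is finite near 0. -/
theorem mem_integrableExpSet_rieszMeasure (ξ : Fin n → ℝ) {s : ℝ}
    (hs : |s| * ∑ a, |ξ a| < 1) :
    s ∈ ProbabilityTheory.integrableExpSet (fun x => -∑ a, ξ a * x a) (rieszMeasure n) := by
  rw [ProbabilityTheory.integrableExpSet, Set.mem_ofPred_eq, integrable_rieszMeasure_iff]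
  refine (integrable_rieszKernel_mul_exp (sub_pos.2 hs)).mono'
    ((measurable_rieszKernel.mul (by fun_prop)).smul (by fun_prop)).aestronglyMeasurable
    (ae_of_all _ fun x => ?_)
  rw [smul_eq_mul, Real.norm_of_nonneg (mul_nonneg (mul_nonneg (rieszKernel_nonneg x)
    (Real.exp_pos _).le) (Real.exp_pos _).le), mul_assoc, ← Real.exp_add]
  by_cases hx : x ∈ forwardCone n
  · refine mul_le_mul_of_nonneg_left (Real.exp_le_exp.2 ?_) (rieszKernel_nonneg x)
    have h1 : |∑ a, ξ a * x a| ≤ (∑ a, |ξ a|) * x 0 := by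
      rw [Finset.sum_mul]
      refine (Finset.abs_sum_le_sum_abs _ _).trans (Finset.sum_le_sum fun a _ => ?_)
      rw [abs_mul]
      gcongr
      exact abs_apply_le_of_mem_forwardCone hx a
    have h2 : s * -∑ a, ξ a * x a ≤ |s| * ((∑ a, |ξ a|) * x 0) := by
      refine (le_abs_self _).trans ?_
      rw [abs_mul, abs_neg]
      gcongr
    linarith
  · simp [rieszKernel_of_notMem hx]

/-- Analytic continuation of z ↦ ζ = (1, 0, …, 0) + zξ from small real z, where ζ is still timelike,
to z = i. -/
theorem laplace_rieszKernel_complex (ξ : Fin n → ℝ) :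
    (∫ x : Fin n → ℝ, (rieszKernel x : ℂ) *
        Complex.exp (-(x 0 + Complex.I * ∑ a, (ξ a : ℂ) * x a))) *
      (∑ a, (eta a a : ℂ) * ((Pi.single 0 1 : Fin n → ℂ) a + Complex.I * ξ a) ^ 2) ^ n =
    (-1) ^ n * ((∫ x : Fin n → ℝ, rieszKernel x * Real.exp (-x 0) : ℝ) : ℂ) := by
  set X : (Fin n → ℝ) → ℝ := fun x => -∑ a, ξ a * x a with hX
  set U : Set ℂ := {z | z.re ∈ interior (ProbabilityTheory.integrableExpSet X (rieszMeasure n))}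
    with hU
  have hδ : 0 ∈ interior (ProbabilityTheory.integrableExpSet X (rieszMeasure n)) := by
    rw [mem_interior_iff_mem_nhds]
    have hc : Continuous fun s : ℝ => |s| * ∑ a, |ξ a| := by fun_prop
    filter_upwards [(hc.tendsto 0).eventually_lt_const (by simp : |(0:ℝ)| * ∑ a, |ξ a| < 1)]
      with s hs using mem_integrableExpSet_rieszMeasure ξ hs
  have hmgf (z : ℂ) : ProbabilityTheory.complexMGF X (rieszMeasure n) z =
      ∫ x : Fin n → ℝ, (rieszKernel x : ℂ) *
        Complex.exp (-(x 0 + z * ∑ a, (ξ a : ℂ) * x a)) := by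
    rw [ProbabilityTheory.complexMGF, integral_rieszMeasure]
    refine integral_congr_ae (ae_of_all _ fun x => ?_)
    simp only [hX, Complex.real_smul]
    push_cast
    rw [mul_assoc, ← Complex.exp_add]
    ring_nf
  set F : ℂ → ℂ := fun z => ProbabilityTheory.complexMGF X (rieszMeasure n) z *
    (∑ a, (eta a a : ℂ) * ((Pi.single 0 1 : Fin n → ℂ) a + z * ξ a) ^ 2) ^ n with hF
  have hFa : AnalyticOnNhd ℂ F U := by
    refine AnalyticOnNhd.mul ProbabilityTheory.analyticOnNhd_complexMGF ?_
    refine DifferentiableOn.analyticOnNhd ?_ (isOpen_interior.preimage Complex.continuous_re)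
    fun_prop
  have hreal : ∀ᶠ s : ℝ in 𝓝 0, F s =
      (-1) ^ n * ((∫ x : Fin n → ℝ, rieszKernel x * Real.exp (-x 0) : ℝ) : ℂ) := by
    set ζ : ℝ → Fin n → ℝ := fun s => Pi.single 0 1 + s • ξ with hζ
    have hζc : Continuous ζ := by fun_prop
    have c1 : Continuous fun s => ζ s 0 := by fun_prop
    have c2 : Continuous fun s => minkowski (ζ s) (ζ s) := continuous_minkowski_self.comp hζc
    filter_upwards [(c1.tendsto 0).eventually_const_lt (by simp [hζ] : (0 : ℝ) < ζ 0 0),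
      (c2.tendsto 0).eventually_lt_const
        (by simp [hζ, minkowski_single_zero] : minkowski (ζ 0) (ζ 0) < 0)] with s h1 h2
    have := congrArg (fun r : ℝ => (r : ℂ)) (laplace_rieszKernel h1 h2)
    simp only [hF, hmgf]
    push_cast at this ⊢
    rw [← this]
    congr 2
    · rw [← integral_complex_ofReal]
      refine integral_congr_ae (ae_of_all _ fun x => ?_)
      simp only [hζ]
      push_cast
      congr 3
      simp [add_mul, Finset.sum_add_distrib, Finset.mul_sum, Pi.single_apply, mul_assoc,
        apply_ite Complex.ofReal]
    · rw [minkowski_apply]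
      push_cast
      refine Finset.sum_congr rfl fun a _ => ?_
      by_cases ha : a = 0
      · subst ha; simp [hζ]; ring
      · simp [hζ, ha]; ring
  -- The domain is a vertical strip around the imaginary axis, hence convex; real points
  -- accumulating at 0 determine the function, and i has real part 0.
  have key := hFa.eqOn_of_preconnected_of_frequently_eq
    (g := fun _ => (-1) ^ n * ((∫ x : Fin n → ℝ, rieszKernel x * Real.exp (-x 0) : ℝ) : ℂ))
    analyticOnNhd_const
    ((ProbabilityTheory.convex_integrableExpSet.interior.linear_preimage
      Complex.reLm).isPreconnected) (z₀ := 0) (by simpa [hU] using hδ) (by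
      have ht : Tendsto (fun s : ℝ => (s : ℂ)) (𝓝[≠] 0) (𝓝[≠] 0) := by
        refine tendsto_nhdsWithin_of_tendsto_nhds_of_eventually_within _
          ((Complex.continuous_ofReal.tendsto' 0 0 (by simp)).mono_left nhdsWithin_le_nhds) ?_
        filter_upwards [self_mem_nhdsWithin] with s hs
        simpa using hs
      exact ht.frequently (hreal.filter_mono nhdsWithin_le_nhds).frequently)
    (show Complex.I ∈ U by simpa [hU] using hδ)
  simp only [hF, hmgf] at key
  exact key

/-! ### The Riesz kernel inverts a power of the d'Alembertian on test functions -/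

theorem eq_zero_of_fourier_eq_zero {m : ℕ} {h : (Fin m → ℝ) → ℂ} (hc : Continuous h) (hi : Integrable h)
    (h0 : ∀ ξ : Fin m → ℝ, ∫ x, Complex.exp (-(Complex.I * ∑ a, (ξ a : ℂ) * x a)) * h x = 0) :
    h = 0 := by
  have hmp := PiLp.volume_preserving_ofLp (Fin m)
  have hme : MeasurableEmbedding (WithLp.ofLp : EuclideanSpace ℝ (Fin m) → Fin m → ℝ) :=
    (MeasurableEquiv.toLp 2 (Fin m → ℝ)).symm.measurableEmbedding
  set h' : EuclideanSpace ℝ (Fin m) → ℂ := fun v => h v.ofLp with hh'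
  have hc' : Continuous h' := by fun_prop
  have hi' : Integrable h' := hmp.integrable_comp_of_integrable hi
  have hF : 𝓕 h' = 0 := by
    ext w
    rw [Real.fourier_eq' h' w]
    -- The frequency is rescaled because the Fourier transform on `EuclideanSpace` carries 2π in its
    -- exponent.
    refine Eq.trans ?_ (h0 fun a => 2 * Real.pi * w a)
    rw [← hmp.integral_comp hme]
    refine integral_congr_ae (ae_of_all _ fun v => ?_)
    simp only [hh', smul_eq_mul]
    congr 2
    simp only [PiLp.inner_apply, RCLike.inner_apply, conj_trivial]
    push_cast
    simp only [Finset.mul_sum, Finset.sum_mul, ← Finset.sum_neg_distrib]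
    refine Finset.sum_congr rfl fun a _ => ?_
    ring
  have hinv := hc'.fourierInv_fourier_eq hi' (by rw [hF]; exact integrable_zero _ _ _)
  rw [hF] at hinv
  ext x
  have := congrFun hinv (WithLp.toLp 2 x)
  rw [Real.fourierInv_eq'] at this
  simpa [hh'] using this.symm

/-! ### Derivatives of past-compact functions and their Laplace transforms. -/

theorem coe_contDiff (f : Scalar n) : ContDiff ℝ ∞ (f : (Fin n → ℝ) → ℝ) := f.2.1

theorem coe_continuous (f : Scalar n) : Continuous (f : (Fin n → ℝ) → ℝ) := f.2.1.continuous

theorem coe_differentiable (f : Scalar n) : Differentiable ℝ (f : (Fin n → ℝ) → ℝ) :=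
  f.2.1.differentiable (by simp)

theorem partialD_apply (a : Fin n) (f : Scalar n) (x : Fin n → ℝ) :
    (partialD a f : (Fin n → ℝ) → ℝ) x = fderiv ℝ f x (Pi.single a 1) := rfl

theorem dAlembert_eq (f : Scalar n) :
    dAlembert f = ∑ a, eta a a • partialD a (partialD a f) := by
  simp only [dAlembert, LinearMap.sum_apply, LinearMap.smul_apply, LinearMap.comp_apply]
  exact Finset.sum_congr rfl fun a _ => sum_eta_smul a fun b => partialD a (partialD b f)

theorem dAlembert_apply (f : Scalar n) (x : Fin n → ℝ) :
    (dAlembert f : (Fin n → ℝ) → ℝ) x =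
      ∑ a, eta a a * (partialD a (partialD a f) : (Fin n → ℝ) → ℝ) x := by
  rw [dAlembert_eq]
  simp

theorem tsupport_partialD_subset (a : Fin n) (f : Scalar n) :
    tsupport (partialD a f : (Fin n → ℝ) → ℝ) ⊆ tsupport (f : (Fin n → ℝ) → ℝ) :=
  tsupport_fderiv_apply_subset ℝ _

theorem tsupport_dAlembert_subset (f : Scalar n) :
    tsupport (dAlembert f : (Fin n → ℝ) → ℝ) ⊆ tsupport (f : (Fin n → ℝ) → ℝ) := by
  refine closure_minimal (fun x hx => ?_) (isClosed_tsupport _)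
  by_contra h
  refine hx ?_
  rw [dAlembert_apply]
  refine Finset.sum_eq_zero fun a _ => ?_
  exact mul_eq_zero_of_right _ (image_eq_zero_of_notMem_tsupport fun h' =>
    h (tsupport_partialD_subset a f (tsupport_partialD_subset a _ h')))

theorem tsupport_dAlembert_pow_subset (m : ℕ) (f : Scalar n) :
    tsupport ((dAlembert ^ m : Module.End ℝ (Scalar n)) f : (Fin n → ℝ) → ℝ) ⊆
      tsupport (f : (Fin n → ℝ) → ℝ) := by
  induction m with
  | zero => simp
  | succ m ih =>
    rw [pow_succ', Module.End.mul_apply]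
    exact (tsupport_dAlembert_subset _).trans ih

theorem hasCompactSupport_of_tsupport_subset {α : Type*} [TopologicalSpace α] {f g : α → ℝ} (hf : HasCompactSupport f)
    (h : tsupport g ⊆ tsupport f) : HasCompactSupport g :=
  hf.of_isClosed_subset (isClosed_tsupport _) h

/-- The complex exponential `exp (-ζ·x)` with `ζ = (1, 0, …, 0) + i ξ`. -/
def planeExp (ξ x : Fin n → ℝ) : ℂ := Complex.exp (-(x 0 + Complex.I * ∑ a, (ξ a : ℂ) * x a))

theorem contDiff_planeExp (ξ : Fin n → ℝ) : ContDiff ℝ ∞ (planeExp ξ) := by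
  unfold planeExp
  have h (a : Fin n) : ContDiff ℝ ∞ fun x : Fin n → ℝ => (x a : ℂ) :=
    Complex.ofRealCLM.contDiff.comp (contDiff_apply ℝ ℝ a)
  refine ContDiff.cexp ?_
  exact ((h 0).add (contDiff_const.mul (ContDiff.sum fun a _ => contDiff_const.mul (h a)))).neg

theorem continuous_planeExp (ξ : Fin n → ℝ) : Continuous (planeExp ξ) :=
  (contDiff_planeExp ξ).continuous

theorem planeExp_add (ξ x y : Fin n → ℝ) :
    planeExp ξ (x + y) = planeExp ξ x * planeExp ξ y := by
  rw [planeExp, planeExp, planeExp, ← Complex.exp_add]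
  congr 1
  simp only [Pi.add_apply, Complex.ofReal_add, mul_add, Finset.sum_add_distrib]
  ring

theorem norm_planeExp (ξ x : Fin n → ℝ) : ‖planeExp ξ x‖ = Real.exp (-x 0) := by
  rw [planeExp, Complex.norm_exp]
  congr 1
  have : (Complex.I * ∑ a, (ξ a : ℂ) * x a).re = 0 := by
    rw [show ∑ a, (ξ a : ℂ) * x a = ((∑ a, ξ a * x a : ℝ) : ℂ) by push_cast; rfl]
    simp
  simp only [Complex.neg_re, Complex.add_re, Complex.ofReal_re, this, add_zero]

theorem fderiv_planeExp (ξ x : Fin n → ℝ) (a : Fin n) :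
    fderiv ℝ (planeExp ξ) x (Pi.single a 1) =
      -((Pi.single 0 1 : Fin n → ℂ) a + Complex.I * ξ a) * planeExp ξ x := by
  have h (b : Fin n) : HasFDerivAt (fun x : Fin n → ℝ => (x b : ℂ))
      (Complex.ofRealCLM.comp (ContinuousLinearMap.proj b)) x :=
    (Complex.ofRealCLM.comp (ContinuousLinearMap.proj (R := ℝ) (φ := fun _ : Fin n => ℝ) b)).hasFDerivAt
  have h2 := (((h 0).add ((HasFDerivAt.fun_sum (u := Finset.univ)
    fun b _ => (h b).const_mul (ξ b : ℂ)).const_mul Complex.I)).neg).cexp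
  have h3 : fderiv ℝ (planeExp ξ) x = _ := h2.fderiv
  rw [h3]
  by_cases ha : a = 0
  · subst ha
    simp [planeExp, Pi.single_apply, apply_ite Complex.ofReal]
    ring
  · simp [planeExp, Pi.single_apply, ha, Ne.symm ha, apply_ite Complex.ofReal]
    ring

theorem integrable_planeExp_mul (ξ : Fin n → ℝ) {f : Scalar n}
    (hf : HasCompactSupport (f : (Fin n → ℝ) → ℝ)) :
    Integrable fun x => planeExp ξ x * ((f : (Fin n → ℝ) → ℝ) x : ℂ) := by
  refine Continuous.integrable_of_hasCompactSupport
    ((continuous_planeExp ξ).mul (Complex.continuous_ofReal.comp (coe_continuous f))) ?_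
  exact (hf.comp_left (g := fun r : ℝ => (r : ℂ)) (by simp)).mul_left

theorem laplace_partialD (ξ : Fin n → ℝ) (a : Fin n) {f : Scalar n}
    (hf : HasCompactSupport (f : (Fin n → ℝ) → ℝ)) :
    ∫ x, planeExp ξ x * ((partialD a f : (Fin n → ℝ) → ℝ) x : ℂ) =
      ((Pi.single 0 1 : Fin n → ℂ) a + Complex.I * ξ a) *
        ∫ x, planeExp ξ x * ((f : (Fin n → ℝ) → ℝ) x : ℂ) := by
  have hd (x : Fin n → ℝ) : HasFDerivAt (fun x => ((f : (Fin n → ℝ) → ℝ) x : ℂ))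
      (Complex.ofRealCLM.comp (fderiv ℝ f x)) x :=
    Complex.ofRealCLM.hasFDerivAt.comp x (coe_differentiable f x).hasFDerivAt
  have hd' (x : Fin n → ℝ) : fderiv ℝ (fun x => ((f : (Fin n → ℝ) → ℝ) x : ℂ)) x (Pi.single a 1) =
      ((partialD a f : (Fin n → ℝ) → ℝ) x : ℂ) := by
    rw [(hd x).fderiv]
    rfl
  have hcd := hasCompactSupport_of_tsupport_subset hf (tsupport_partialD_subset a f)
  have := integral_mul_fderiv_eq_neg_fderiv_mul_of_integrable (μ := volume) (f := planeExp ξ)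
    (g := fun x => ((f : (Fin n → ℝ) → ℝ) x : ℂ)) (v := Pi.single a 1)
    (by
      simp_rw [fderiv_planeExp, mul_assoc]
      exact (integrable_planeExp_mul ξ hf).const_mul _)
    (by
      simp_rw [hd']
      exact integrable_planeExp_mul ξ hcd)
    (integrable_planeExp_mul ξ hf)
    (fun x _ => (contDiff_planeExp ξ).differentiable (by simp) x)
    (fun x _ => (hd x).differentiableAt)
  simp_rw [hd', fderiv_planeExp, mul_assoc] at this
  rw [this, integral_const_mul]
  ring

theorem laplace_dAlembert (ξ : Fin n → ℝ) {f : Scalar n}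
    (hf : HasCompactSupport (f : (Fin n → ℝ) → ℝ)) :
    ∫ x, planeExp ξ x * ((dAlembert f : (Fin n → ℝ) → ℝ) x : ℂ) =
      (∑ a, (eta a a : ℂ) * ((Pi.single 0 1 : Fin n → ℂ) a + Complex.I * ξ a) ^ 2) *
        ∫ x, planeExp ξ x * ((f : (Fin n → ℝ) → ℝ) x : ℂ) := by
  have h1 (a : Fin n) := hasCompactSupport_of_tsupport_subset hf (tsupport_partialD_subset a f)
  have h2 (a : Fin n) :=
    hasCompactSupport_of_tsupport_subset (h1 a) (tsupport_partialD_subset a (partialD a f))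
  have h3 (x : Fin n → ℝ) : planeExp ξ x * ((dAlembert f : (Fin n → ℝ) → ℝ) x : ℂ) =
      ∑ a, (eta a a : ℂ) *
        (planeExp ξ x * ((partialD a (partialD a f) : (Fin n → ℝ) → ℝ) x : ℂ)) := by
    rw [dAlembert_apply]
    push_cast
    rw [Finset.mul_sum]
    exact Finset.sum_congr rfl fun a _ => by ring
  simp_rw [h3]
  rw [integral_finsetSum _ fun a _ => (integrable_planeExp_mul ξ (h2 a)).const_mul _,
    Finset.sum_mul]
  refine Finset.sum_congr rfl fun a _ => ?_
  rw [integral_const_mul, laplace_partialD ξ a (h1 a), laplace_partialD ξ a hf]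
  ring

theorem laplace_dAlembert_pow (ξ : Fin n → ℝ) {f : Scalar n}
    (hf : HasCompactSupport (f : (Fin n → ℝ) → ℝ)) (m : ℕ) :
    ∫ x, planeExp ξ x *
        (((dAlembert ^ m : Module.End ℝ (Scalar n)) f : (Fin n → ℝ) → ℝ) x : ℂ) =
      (∑ a, (eta a a : ℂ) * ((Pi.single 0 1 : Fin n → ℂ) a + Complex.I * ξ a) ^ 2) ^ m *
        ∫ x, planeExp ξ x * ((f : (Fin n → ℝ) → ℝ) x : ℂ) := by
  induction m with
  | zero => simp
  | succ m ih =>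
    rw [pow_succ', Module.End.mul_apply, laplace_dAlembert ξ
      (hasCompactSupport_of_tsupport_subset hf (tsupport_dAlembert_pow_subset m f)), ih]
    ring

/-- The normalisation constant of the Riesz kernel. -/
def rieszConst (n : ℕ) [NeZero n] : ℝ :=
  (-1) ^ n * ∫ x : Fin n → ℝ, rieszKernel x * Real.exp (-x 0)

theorem rieszConst_ne_zero : rieszConst n ≠ 0 :=
  mul_ne_zero (by simp) integral_rieszKernel_pos.ne'

theorem integrable_planeExp_mul_rieszKernel (ξ : Fin n → ℝ) :
    Integrable fun x => planeExp ξ x * (rieszKernel x : ℂ) := by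
  have h := integrable_rieszKernel_mul_exp (n := n) one_pos
  refine h.mono' ((continuous_planeExp ξ).measurable.mul
    (Complex.measurable_ofReal.comp measurable_rieszKernel)).aestronglyMeasurable
    (ae_of_all _ fun x => ?_)
  rw [norm_mul, norm_planeExp, Complex.norm_real, Real.norm_of_nonneg (rieszKernel_nonneg x),
    mul_comm, one_mul]

/-- `planeExp ξ` is multiplicative, so the weight distributes over both factors; the weighted kernel
is integrable although the kernel is not. -/
theorem planeExp_mul_convolution (ξ : Fin n → ℝ) (g : (Fin n → ℝ) → ℝ) (x : Fin n → ℝ) :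
    planeExp ξ x * ((rieszKernel ⋆ g) x : ℂ) =
      ((fun x => planeExp ξ x * (rieszKernel x : ℂ)) ⋆[ContinuousLinearMap.mul ℝ ℂ]
        fun x => planeExp ξ x * (g x : ℂ)) x := by
  rw [convolution_def, convolution_def, ← integral_complex_ofReal, ← integral_const_mul]
  refine integral_congr_ae (ae_of_all _ fun t => ?_)
  have h : planeExp ξ x = planeExp ξ t * planeExp ξ (x - t) := by
    rw [← planeExp_add, add_sub_cancel]
  simp only [ContinuousLinearMap.lsmul_apply, smul_eq_mul, ContinuousLinearMap.mul_apply', h]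
  push_cast
  ring

theorem riesz_convolution_dAlembert_pow {f : Scalar n}
    (hf : HasCompactSupport (f : (Fin n → ℝ) → ℝ)) (x : Fin n → ℝ) :
    (rieszKernel ⋆ ((dAlembert ^ n : Module.End ℝ (Scalar n)) f : (Fin n → ℝ) → ℝ)) x =
      rieszConst n * (f : (Fin n → ℝ) → ℝ) x := by
  set g := (dAlembert ^ n : Module.End ℝ (Scalar n)) f with hg
  have hgc : HasCompactSupport (g : (Fin n → ℝ) → ℝ) :=
    hasCompactSupport_of_tsupport_subset hf (tsupport_dAlembert_pow_subset n f)
  have hint (ξ : Fin n → ℝ) :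
      Integrable fun x => planeExp ξ x * ((rieszKernel ⋆ (g : (Fin n → ℝ) → ℝ)) x : ℂ) := by
    simp_rw [planeExp_mul_convolution]
    exact (integrable_planeExp_mul_rieszKernel ξ).integrable_convolution _
      (integrable_planeExp_mul ξ hgc)
  have hcont : Continuous (rieszKernel ⋆ (g : (Fin n → ℝ) → ℝ)) :=
    hgc.continuous_convolution_right _ locallyIntegrable_rieszKernel (coe_continuous g)
  -- The weight `planeExp 0 x`, which is `exp (-x 0)`, makes the difference of the two sides
  -- integrable; its Fourier transform vanishes by the Laplace identity.
  set h : (Fin n → ℝ) → ℂ := fun x => planeExp 0 x * ((rieszKernel ⋆ (g : (Fin n → ℝ) → ℝ)) x : ℂ)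
    - rieszConst n * (planeExp 0 x * ((f : (Fin n → ℝ) → ℝ) x : ℂ)) with hh
  have h0 : h = 0 := by
    refine eq_zero_of_fourier_eq_zero ?_ ((hint 0).sub
      ((integrable_planeExp_mul 0 hf).const_mul _)) fun ξ => ?_
    · have h1 := continuous_planeExp (0 : Fin n → ℝ)
      have h2 := coe_continuous f
      fun_prop
    · have h1 (x : Fin n → ℝ) : Complex.exp (-(Complex.I * ∑ a, (ξ a : ℂ) * x a)) * h x =
          planeExp ξ x * ((rieszKernel ⋆ (g : (Fin n → ℝ) → ℝ)) x : ℂ)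
            - rieszConst n * (planeExp ξ x * ((f : (Fin n → ℝ) → ℝ) x : ℂ)) := by
        have h2 : planeExp ξ x =
            Complex.exp (-(Complex.I * ∑ a, (ξ a : ℂ) * x a)) * planeExp 0 x := by
          rw [planeExp, planeExp, ← Complex.exp_add]
          congr 1
          simp
        rw [h2]
        simp only [hh]
        ring
      simp_rw [h1]
      rw [integral_sub (hint ξ) ((integrable_planeExp_mul ξ hf).const_mul _), integral_const_mul]
      simp_rw [planeExp_mul_convolution]
      rw [integral_convolution _ (integrable_planeExp_mul_rieszKernel ξ)
        (integrable_planeExp_mul ξ hgc), hg, laplace_dAlembert_pow ξ hf,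
        ContinuousLinearMap.mul_apply', ← mul_assoc]
      have h3 := laplace_rieszKernel_complex ξ
      have h4 : (rieszConst n : ℂ) = (-1) ^ n *
          ((∫ x : Fin n → ℝ, rieszKernel x * Real.exp (-x 0) : ℝ) : ℂ) := by
        simp [rieszConst]
      rw [h4, ← h3]
      simp only [planeExp, mul_comm (Complex.exp _)]
      ring
  have h5 := congrFun h0 x
  simp only [hh, Pi.zero_apply] at h5
  have h6 : planeExp 0 x ≠ 0 := Complex.exp_ne_zero _
  rw [mul_left_comm, ← mul_sub, mul_eq_zero, or_iff_right h6, sub_eq_zero] at h5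
  exact_mod_cast h5

/-! ### Causal sets and localization -/

theorem causalPast_subset {p q : Fin n → ℝ} (h : q ∈ causalPast p) :
    causalPast q ⊆ causalPast p := fun x hx => by
  rw [mem_causalPast_iff] at *
  simpa using add_mem_forwardCone h hx

theorem self_mem_causalPast (p : Fin n → ℝ) : p ∈ causalPast p := by
  rw [mem_causalPast_iff, sub_self]
  exact zero_mem_forwardCone

/-- Moving up by one unit of time makes the past a neighbourhood of `p`, so agreement on a single
causal past controls germs at `p`. -/
theorem eventually_mem_causalPast (p : Fin n → ℝ) :
    ∀ᶠ x in 𝓝 p, x ∈ causalPast (p + Pi.single 0 1) := by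
  have c1 : Continuous fun x : Fin n → ℝ => (p + Pi.single 0 1 - x : Fin n → ℝ) 0 := by fun_prop
  have c2 : Continuous fun x : Fin n → ℝ =>
      minkowski (p + Pi.single 0 1 - x) (p + Pi.single 0 1 - x) :=
    continuous_minkowski_self.comp (by fun_prop)
  filter_upwards [(c1.tendsto p).eventually_const_lt (u := 0) (by simp),
    (c2.tendsto p).eventually_lt_const (u := 0) (by simp [minkowski_single_zero])] with x h1 h2
  exact mem_causalPast_iff.2 ⟨h1.le, h2.le⟩

/-- Points near `p` can only be reached from a compact piece of `A`, and the sum of a compact set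
and the closed cone is closed. -/
theorem isClosed_causalFuture {A : Set (Fin n → ℝ)} (hA : IsPastCompact A) :
    IsClosed (causalFuture A) := by
  rw [← isOpen_compl_iff, isOpen_iff_mem_nhds]
  intro p hp
  have hc := isClosed_forwardCone.add_left_of_isCompact (hA (p + Pi.single 0 1))
  have hp' : p ∉ A ∩ causalPast (p + Pi.single 0 1) + forwardCone n := by
    rintro ⟨q, hq, c, hcone, rfl⟩
    exact hp ⟨q, hq.1, mem_causalPast_iff.2 (by simpa using hcone)⟩
  filter_upwards [hc.isOpen_compl.mem_nhds hp', eventually_mem_causalPast p] with x hx hxp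
  rintro ⟨q, hqA, hq⟩
  exact hx ⟨q, ⟨hqA, causalPast_subset hxp hq⟩, x - q, mem_causalPast_iff.1 hq, by simp⟩

theorem isPastCompact_causalFuture {A : Set (Fin n → ℝ)} (hA : IsPastCompact A) :
    IsPastCompact (causalFuture A) := fun p => by
  obtain ⟨R, hR⟩ := (hA p).isBounded.exists_norm_le
  refine Metric.isCompact_of_isClosed_isBounded
    ((isClosed_causalFuture hA).inter (isClosed_causalPast p))
    -- For `q` ≤ `x` ≤ `p` causally, each |p a - x a| is at most p 0 - x 0 ≤ p 0 - q 0 ≤ ‖p‖ + R.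
    (Metric.isBounded_closedBall (x := p) (r := ‖p‖ + R) |>.subset ?_)
  rintro x ⟨⟨q, hqA, hq⟩, hx⟩
  have hqR := hR q ⟨hqA, causalPast_subset hx hq⟩
  rw [mem_causalPast_iff] at hx hq
  have h1 := hq.1
  have h2 := (norm_le_pi_norm q 0).trans hqR
  have h3 := norm_le_pi_norm p 0
  rw [Real.norm_eq_abs, abs_le] at h2 h3
  have h0 := hx.1
  simp only [Pi.sub_apply] at h1 h0
  rw [mem_closedBall_iff_norm, norm_sub_rev, pi_norm_le_iff_of_nonneg (by linarith)]
  intro a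
  have h4 := abs_apply_le_of_mem_forwardCone hx a
  simp only [Pi.sub_apply] at h4
  rw [Pi.sub_apply, Real.norm_eq_abs]
  linarith

/-- Near the causal past of a point, a past-compact function agrees with a test function. -/
theorem exists_hasCompactSupport_eventuallyEq (f : Scalar n) (p : Fin n → ℝ) :
    ∃ g : Scalar n, HasCompactSupport (g : (Fin n → ℝ) → ℝ) ∧
      ∀ q ∈ causalPast p, (f : (Fin n → ℝ) → ℝ) =ᶠ[𝓝 q] (g : (Fin n → ℝ) → ℝ) := by
  obtain ⟨R, hR0, hR⟩ := (f.2.2 p).isBounded.exists_pos_norm_lt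
  let χ : ContDiffBump (0 : Fin n → ℝ) := ⟨R, R + 1, hR0, by linarith⟩
  refine ⟨⟨fun x => χ x * (f : (Fin n → ℝ) → ℝ) x, χ.contDiff.mul (coe_contDiff f),
    f.2.2.mono (isClosed_tsupport _) (tsupport_mul_subset_right (f := (χ : (Fin n → ℝ) → ℝ)))⟩,
    χ.hasCompactSupport.mul_right, fun q hq => ?_⟩
  by_cases h : q ∈ tsupport (f : (Fin n → ℝ) → ℝ)
  · have hq' : q ∈ Metric.ball (0 : Fin n → ℝ) χ.rIn := by
      rw [mem_ball_zero_iff]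
      exact hR q ⟨h, hq⟩
    filter_upwards [χ.eventuallyEq_one_of_mem_ball hq'] with x hx
    simp [hx]
  · filter_upwards [notMem_tsupport_iff_eventuallyEq.1 h] with x hx
    simp [hx]

theorem eventuallyEq_partialD {f g : Scalar n} {q : Fin n → ℝ}
    (h : (f : (Fin n → ℝ) → ℝ) =ᶠ[𝓝 q] g) (a : Fin n) :
    (partialD a f : (Fin n → ℝ) → ℝ) =ᶠ[𝓝 q] (partialD a g : (Fin n → ℝ) → ℝ) := by
  filter_upwards [h.fderiv (𝕜 := ℝ)] with x hx
  rw [partialD_apply, partialD_apply, hx]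

theorem eventuallyEq_dAlembert {f g : Scalar n} {q : Fin n → ℝ}
    (h : (f : (Fin n → ℝ) → ℝ) =ᶠ[𝓝 q] g) :
    (dAlembert f : (Fin n → ℝ) → ℝ) =ᶠ[𝓝 q] (dAlembert g : (Fin n → ℝ) → ℝ) := by
  filter_upwards [eventually_all.2 fun a => eventuallyEq_partialD (eventuallyEq_partialD h a) a]
    with x hx
  simp only [dAlembert_apply, hx]

theorem eventuallyEq_dAlembert_pow {f g : Scalar n} {q : Fin n → ℝ}
    (h : (f : (Fin n → ℝ) → ℝ) =ᶠ[𝓝 q] g) (m : ℕ) :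
    ((dAlembert ^ m : Module.End ℝ (Scalar n)) f : (Fin n → ℝ) → ℝ) =ᶠ[𝓝 q]
      ((dAlembert ^ m : Module.End ℝ (Scalar n)) g : (Fin n → ℝ) → ℝ) := by
  induction m with
  | zero => simpa using h
  | succ m ih =>
    simp only [pow_succ', Module.End.mul_apply]
    exact eventuallyEq_dAlembert ih

/-! ### Extending the Riesz convolution from test functions to past-compact functions. -/

theorem riesz_integrand_congr {f g : (Fin n → ℝ) → ℝ} {p x : Fin n → ℝ}
    (h : ∀ q ∈ causalPast p, f q = g q) (hx : x ∈ causalPast p) (t : Fin n → ℝ) :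
    ContinuousLinearMap.lsmul ℝ ℝ (rieszKernel t) (f (x - t)) =
      ContinuousLinearMap.lsmul ℝ ℝ (rieszKernel t) (g (x - t)) := by
  by_cases ht : t ∈ forwardCone n
  · rw [h _ (causalPast_subset hx (mem_causalPast_iff.2 (by simpa using ht)))]
  · simp [rieszKernel_of_notMem ht]

theorem riesz_convolution_congr {f g : (Fin n → ℝ) → ℝ} {p x : Fin n → ℝ}
    (h : ∀ q ∈ causalPast p, f q = g q) (hx : x ∈ causalPast p) :
    (rieszKernel ⋆ f) x = (rieszKernel ⋆ g) x := by
  rw [convolution_def, convolution_def]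
  simp_rw [riesz_integrand_congr h hx]

theorem riesz_convolutionExistsAt (f : Scalar n) (x : Fin n → ℝ) :
    ConvolutionExistsAt rieszKernel (f : (Fin n → ℝ) → ℝ) x (ContinuousLinearMap.lsmul ℝ ℝ) := by
  obtain ⟨g, hg, hfg⟩ := exists_hasCompactSupport_eventuallyEq f x
  have h := hg.convolutionExists_right (ContinuousLinearMap.lsmul ℝ ℝ)
    (locallyIntegrable_rieszKernel (n := n)) (coe_continuous g) x
  unfold ConvolutionExistsAt at *
  simpa only [riesz_integrand_congr (fun q hq => (hfg q hq).eq_of_nhds)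
    (self_mem_causalPast x)] using h

theorem riesz_convolution_eventuallyEq {f g : (Fin n → ℝ) → ℝ} {p : Fin n → ℝ}
    (h : ∀ q ∈ causalPast (p + Pi.single 0 1), f q = g q) :
    (rieszKernel ⋆ f) =ᶠ[𝓝 p] (rieszKernel ⋆ g) := by
  filter_upwards [eventually_mem_causalPast p] with x hx using riesz_convolution_congr h hx

theorem contDiff_riesz_convolution (f : Scalar n) :
    ContDiff ℝ ∞ (rieszKernel ⋆ (f : (Fin n → ℝ) → ℝ)) := by
  rw [contDiff_iff_contDiffAt]
  intro p
  obtain ⟨g, hg, hfg⟩ := exists_hasCompactSupport_eventuallyEq f (p + Pi.single 0 1)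
  exact (hg.contDiff_convolution_right _ locallyIntegrable_rieszKernel
    (coe_contDiff g)).contDiffAt.congr_of_eventuallyEq
    (riesz_convolution_eventuallyEq fun q hq => (hfg q hq).eq_of_nhds)

theorem tsupport_riesz_convolution_subset (f : Scalar n) :
    tsupport (rieszKernel ⋆ (f : (Fin n → ℝ) → ℝ)) ⊆
      causalFuture (tsupport (f : (Fin n → ℝ) → ℝ)) := by
  refine closure_minimal (fun x hx => ?_) (isClosed_causalFuture f.2.2)
  obtain ⟨t, ht, q, hq, rfl⟩ := support_convolution_subset _ hx
  refine ⟨q, subset_tsupport _ hq, mem_causalPast_iff.2 ?_⟩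
  by_contra h
  exact ht (rieszKernel_of_notMem (by simpa using h))

/-! ### The retarded Green operator -/

/-- Convolution with the Riesz kernel, as an operator on past-compact functions. -/
def rieszOperator : Scalar n →ₗ[ℝ] Scalar n where
  toFun f := ⟨rieszKernel ⋆ (f : (Fin n → ℝ) → ℝ), contDiff_riesz_convolution f,
    (isPastCompact_causalFuture f.2.2).mono (isClosed_tsupport _)
      (tsupport_riesz_convolution_subset f)⟩
  map_add' f g := Subtype.ext <| funext fun x =>
    (riesz_convolutionExistsAt f x).distrib_add (riesz_convolutionExistsAt g x)
  map_smul' _ _ := Subtype.ext <| convolution_smul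

theorem rieszOperator_apply (f : Scalar n) :
    (rieszOperator f : (Fin n → ℝ) → ℝ) = rieszKernel ⋆ (f : (Fin n → ℝ) → ℝ) := rfl

/-- Both sides at `p` depend on `f` only near the past of `p + Pi.single 0 1`, so `f` may be
replaced by a test function, for which differentiation under the convolution is standard. -/
theorem partialD_rieszOperator (a : Fin n) (f : Scalar n) :
    partialD a (rieszOperator f) = rieszOperator (partialD a f) := by
  ext p
  obtain ⟨g, hg, hfg⟩ := exists_hasCompactSupport_eventuallyEq f (p + Pi.single 0 1)
  rw [partialD_apply, rieszOperator_apply, rieszOperator_apply,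
    (riesz_convolution_eventuallyEq fun q hq => (hfg q hq).eq_of_nhds).fderiv_eq,
    (hg.hasFDerivAt_convolution_right _ locallyIntegrable_rieszKernel
      ((coe_contDiff g).of_le (by simp)) p).fderiv,
    convolution_precompR_apply _ locallyIntegrable_rieszKernel (hg.fderiv ℝ)
      ((coe_contDiff g).continuous_fderiv (by simp))]
  exact (riesz_convolution_eventuallyEq fun q hq =>
    (eventuallyEq_partialD (hfg q hq) a).eq_of_nhds).eq_of_nhds.symm

theorem dAlembert_rieszOperator (f : Scalar n) :
    dAlembert (rieszOperator f) = rieszOperator (dAlembert f) := by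
  simp only [dAlembert_eq, partialD_rieszOperator, map_sum, map_smul]

theorem rieszOperator_dAlembert_pow (f : Scalar n) :
    rieszOperator ((dAlembert ^ n : Module.End ℝ (Scalar n)) f) = rieszConst n • f := by
  ext p
  obtain ⟨g, hg, hfg⟩ := exists_hasCompactSupport_eventuallyEq f p
  rw [rieszOperator_apply, riesz_convolution_congr
    (fun q hq => (eventuallyEq_dAlembert_pow (hfg q hq) n).eq_of_nhds) (self_mem_causalPast p),
    riesz_convolution_dAlembert_pow hg, ← (hfg p (self_mem_causalPast p)).eq_of_nhds]
  rfl

/-- The retarded Green operator of the d'Alembertian. -/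
def retardedGreen : Scalar n →ₗ[ℝ] Scalar n :=
  (rieszConst n)⁻¹ • rieszOperator ∘ₗ (dAlembert ^ (n - 1) : Module.End ℝ (Scalar n))

theorem retardedGreen_dAlembert (f : Scalar n) : retardedGreen (dAlembert f) = f := by
  have h : (dAlembert ^ (n - 1) : Module.End ℝ (Scalar n)) (dAlembert f) =
      (dAlembert ^ n : Module.End ℝ (Scalar n)) f := by
    rw [← Module.End.mul_apply, ← pow_succ, Nat.sub_one_add_one (NeZero.ne n)]
  simp only [retardedGreen, LinearMap.smul_apply, LinearMap.comp_apply, h,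
    rieszOperator_dAlembert_pow]
  rw [smul_smul, inv_mul_cancel₀ rieszConst_ne_zero, one_smul]

/-- Unlike the left-inverse identity, this needs □ to commute with the Riesz convolution. -/
theorem dAlembert_retardedGreen (f : Scalar n) : dAlembert (retardedGreen f) = f := by
  have h : dAlembert ((dAlembert ^ (n - 1) : Module.End ℝ (Scalar n)) f) =
      (dAlembert ^ n : Module.End ℝ (Scalar n)) f := by
    rw [← Module.End.mul_apply, ← pow_succ', Nat.sub_one_add_one (NeZero.ne n)]
  simp only [retardedGreen, LinearMap.smul_apply, LinearMap.comp_apply, map_smul,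
    dAlembert_rieszOperator, h, rieszOperator_dAlembert_pow]
  rw [smul_smul, inv_mul_cancel₀ rieszConst_ne_zero, one_smul]

theorem causalFuture_mono {A B : Set (Fin n → ℝ)} (h : A ⊆ B) :
    causalFuture A ⊆ causalFuture B := fun _ ⟨q, hq, hp⟩ => ⟨q, h hq, hp⟩

theorem isRetardedGreen_retardedGreen : IsRetardedGreen (retardedGreen (n := n)) where
  dAlembert_comp := dAlembert_retardedGreen
  comp_dAlembert := retardedGreen_dAlembert
  support f := by
    have h := (closure_mono (Function.support_const_smul_subset (rieszConst n)⁻¹ _)).trans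
      (tsupport_riesz_convolution_subset ((dAlembert ^ (n - 1) : Module.End ℝ (Scalar n)) f))
    exact h.trans (causalFuture_mono (tsupport_dAlembert_pow_subset (n - 1) f))

/-- A left inverse of □ must agree with any right inverse. -/
theorem IsRetardedGreen.eq {G : Scalar n →ₗ[ℝ] Scalar n} (hG : IsRetardedGreen G) :
    G = retardedGreen := by
  ext1 f
  conv_lhs => rw [← dAlembert_retardedGreen f]
  exact hG.comp_dAlembert _

end GreenOperator

/-! ### Tensor calculus -/

theorem partialD_comm (a b : Fin n) (f : Scalar n) :
    partialD a (partialD b f) = partialD b (partialD a f) := by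
  have h2 : (2 : WithTop ℕ∞) ≤ ∞ := WithTop.coe_le_coe.2 le_top
  have hd (x : Fin n → ℝ) : DifferentiableAt ℝ (fderiv ℝ (f : (Fin n → ℝ) → ℝ)) x :=
    ((coe_contDiff f).fderiv_right (m := 1) (by norm_num [h2])).differentiable (by simp) x
  have h (a b : Fin n) (x : Fin n → ℝ) : (partialD a (partialD b f) : (Fin n → ℝ) → ℝ) x =
      fderiv ℝ (fderiv ℝ (f : (Fin n → ℝ) → ℝ)) x (Pi.single a 1) (Pi.single b 1) := by
    change fderiv ℝ (fun x => fderiv ℝ (f : (Fin n → ℝ) → ℝ) x (Pi.single b 1)) x _ = _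
    rw [fderiv_clm_apply (hd x) (differentiableAt_const _)]
    simp
  ext x
  rw [h, h]
  exact (coe_contDiff f).contDiffAt.isSymmSndFDerivAt (by simp [h2]) _ _

theorem partialD_dAlembert (a : Fin n) (f : Scalar n) :
    partialD a (dAlembert f) = dAlembert (partialD a f) := by
  simp only [dAlembert_eq, map_sum, map_smul, partialD_comm a]

theorem div1_eq (X : Covector n) : div1 X = ∑ a, eta a a • partialD a (X a) :=
  Finset.sum_congr rfl fun a _ => sum_eta_smul a fun c => partialD c (X a)

theorem div2_apply (h : Tensor2 n) (b : Fin n) :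
    div2 h b = ∑ a, eta a a • partialD a (h a b) :=
  Finset.sum_congr rfl fun a _ => sum_eta_smul a fun c => partialD c (h a b)

theorem trace_eq (h : Tensor2 n) : trace h = ∑ a, eta a a • h a a :=
  Finset.sum_congr rfl fun a _ => sum_eta_smul a fun b => h a b

theorem eta_comm (a b : Fin n) : eta a b = eta b a := by
  simp only [eta]
  grind

theorem div1_add (X Y : Covector n) : div1 (X + Y) = div1 X + div1 Y := by
  simp only [div1_eq, Pi.add_apply, map_add, smul_add, Finset.sum_add_distrib]

theorem div1_smul (c : ℝ) (X : Covector n) : div1 (c • X) = c • div1 X := by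
  simp only [div1_eq, Pi.smul_apply, map_smul, Finset.smul_sum, smul_comm c]

theorem div1_neg (X : Covector n) : div1 (-X) = -div1 X := by
  simp only [div1_eq, Pi.neg_apply, map_neg, smul_neg, Finset.sum_neg_distrib]

theorem div1_partialD (f : Scalar n) : div1 (fun a => partialD a f) = dAlembert f := by
  rw [div1_eq, dAlembert_eq]

theorem div1_dAlembert (X : Covector n) :
    div1 (fun a => dAlembert (X a)) = dAlembert (div1 X) := by
  simp only [div1_eq, map_sum, map_smul, partialD_dAlembert]

theorem div2_add (h k : Tensor2 n) : div2 (h + k) = div2 h + div2 k := by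
  ext1 b
  simp only [div2_apply, Pi.add_apply, map_add, smul_add, Finset.sum_add_distrib]

theorem div2_sub (h k : Tensor2 n) : div2 (h - k) = div2 h - div2 k := by
  ext1 b
  simp only [div2_apply, Pi.sub_apply, map_sub, smul_sub, Finset.sum_sub_distrib]

theorem trace_add (h k : Tensor2 n) : trace (h + k) = trace h + trace k := by
  simp only [trace_eq, Pi.add_apply, smul_add, Finset.sum_add_distrib]

theorem trace_sub (h k : Tensor2 n) : trace (h - k) = trace h - trace k := by
  simp only [trace_eq, Pi.sub_apply, smul_sub, Finset.sum_sub_distrib]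

theorem div2_hessian (f : Scalar n) (b : Fin n) :
    div2 (fun a b => partialD a (partialD b f)) b = partialD b (dAlembert f) := by
  rw [div2_apply, partialD_dAlembert, dAlembert_eq]

theorem div2_eta_smul (c : ℝ) (f : Scalar n) (b : Fin n) :
    div2 (fun a b => (c * eta a b) • f) b = c • partialD b f := by
  simp only [div2_apply, map_smul]
  rw [Finset.sum_eq_single b (fun a _ ha => by simp [eta, ha]) (by simp), smul_smul,
    mul_left_comm, eta_mul_self, mul_one]

theorem div2_vectorPart (v : Covector n) (b : Fin n) :
    div2 (vectorPart v) b = partialD b (div1 v) + dAlembert (v b) := by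
  simp only [div2_apply, vectorPart, map_add, smul_add, Finset.sum_add_distrib, div1_eq,
    dAlembert_eq, map_sum, map_smul, partialD_comm b]
  rw [add_comm]

theorem trace_hessian (f : Scalar n) :
    trace (fun a b => partialD a (partialD b f)) = dAlembert f := by
  rw [trace_eq, dAlembert_eq]

theorem trace_eta_smul (c : ℝ) (f : Scalar n) :
    trace (fun a b => (c * eta a b) • f) = (c * n) • f := by
  simp only [trace_eq, smul_smul, mul_left_comm _ c, eta_mul_self]
  simp [← Nat.cast_smul_eq_nsmul ℝ, smul_smul, mul_comm]

theorem trace_vectorPart (v : Covector n) : trace (vectorPart v) = (2 : ℝ) • div1 v := by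
  simp only [trace_eq, vectorPart, div1_eq, smul_add, Finset.sum_add_distrib, two_smul]

theorem scalarPart_eq (k : Tensor2 n) (w : Scalar n) :
    scalarPart k w = (fun a b => partialD a (partialD b w))
      - (fun a b => (1 / (n : ℝ) * eta a b) • dAlembert w)
      + fun a b => (1 / (n : ℝ) * eta a b) • trace k := rfl

theorem div2_scalarPart (k : Tensor2 n) (w : Scalar n) (b : Fin n) :
    div2 (scalarPart k w) b =
      partialD b ((1 - 1 / (n : ℝ)) • dAlembert w + (1 / (n : ℝ)) • trace k) := by
  rw [scalarPart_eq, div2_add, div2_sub, Pi.add_apply, Pi.sub_apply, div2_hessian, div2_eta_smul,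
    div2_eta_smul, map_add, map_smul, map_smul]
  module

theorem trace_scalarPart (k : Tensor2 n) (w : Scalar n) : trace (scalarPart k w) = trace k := by
  have hn : (n : ℝ) ≠ 0 := Nat.cast_ne_zero.2 (NeZero.ne n)
  rw [scalarPart_eq, trace_add, trace_sub, trace_hessian, trace_eta_smul, trace_eta_smul,
    one_div_mul_cancel hn]
  module

theorem isSymm_scalarPart (k : Tensor2 n) (w : Scalar n) : IsSymm (scalarPart k w) := fun a b => by
  simp only [scalarPart, partialD_comm a b, eta_comm a b]

theorem isSymm_vectorPart (v : Covector n) : IsSymm (vectorPart v) := fun _ _ => add_comm _ _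

theorem isSymm_traceReverse {h : Tensor2 n} (hh : IsSymm h) : IsSymm (traceReverse h) :=
  fun a b => by simp only [traceReverse, hh a b, eta_comm a b]

theorem div2_gaugeTraceReverse (h : Tensor2 n) (X : Covector n) (b : Fin n) :
    div2 (gaugeTraceReverse h X) b = div2 (traceReverse h) b + dAlembert (X b)
      + (1 - 4 / (n : ℝ)) • partialD b (div1 X) := by
  have h1 : gaugeTraceReverse h X = traceReverse h + vectorPart X
      - fun a b => (4 / (n : ℝ) * eta a b) • div1 X := by
    ext1 a
    ext1 b
    simp only [gaugeTraceReverse, vectorPart, Pi.sub_apply, Pi.add_apply, add_assoc]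
  rw [h1, div2_sub, div2_add, Pi.sub_apply, Pi.add_apply, div2_vectorPart, div2_eta_smul]
  module

/-- Past-compactness excludes nonzero homogeneous solutions; every uniqueness claim about the fields
reduces to this. -/
theorem dAlembert_injective : Function.Injective (dAlembert (n := n)) :=
  Function.LeftInverse.injective retardedGreen_dAlembert

/-! ### Scalar-vector-tensor decomposition -/

theorem IsDecomposition.div2_eq {k t : Tensor2 n} {w : Scalar n} {v : Covector n}
    (h : IsDecomposition k w v t) (b : Fin n) :
    div2 k b = partialD b ((1 - 1 / (n : ℝ)) • dAlembert w + (1 / (n : ℝ)) • trace k)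
      + dAlembert (v b) := by
  conv_lhs => rw [h.eq_sum]
  rw [div2_add, div2_add, Pi.add_apply, Pi.add_apply, div2_scalarPart, div2_vectorPart,
    h.vector_transverse, h.tensor_transverse]
  simp

theorem IsDecomposition.div1_div2_eq {k t : Tensor2 n} {w : Scalar n} {v : Covector n}
    (h : IsDecomposition k w v t) :
    div1 (div2 k) = dAlembert ((1 - 1 / (n : ℝ)) • dAlembert w + (1 / (n : ℝ)) • trace k) := by
  have : div2 k =
      (fun b => partialD b ((1 - 1 / (n : ℝ)) • dAlembert w + (1 / (n : ℝ)) • trace k))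
        + fun b => dAlembert (v b) := funext h.div2_eq
  rw [this, div1_add, div1_partialD, div1_dAlembert, h.vector_transverse, map_zero, add_zero]

/-- The double divergence sees only the scalar part and fixes `w`, as 1 - 1/n ≠ 0; the divergence
then fixes `v`, and `t` is what remains. -/
theorem IsDecomposition.unique (hn : 2 ≤ n) {k t t' : Tensor2 n} {w w' : Scalar n}
    {v v' : Covector n} (h : IsDecomposition k w v t) (h' : IsDecomposition k w' v' t') :
    w = w' ∧ v = v' ∧ t = t' := by
  have hn' : (1 - 1 / (n : ℝ)) ≠ 0 := by
    have : (2 : ℝ) ≤ n := by exact_mod_cast hn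
    have h1 : 1 / (n : ℝ) < 1 := by rw [div_lt_iff₀] <;> linarith
    linarith
  have h1 := dAlembert_injective (h.div1_div2_eq.symm.trans h'.div1_div2_eq)
  obtain rfl : w = w' := dAlembert_injective (smul_right_injective _ hn' (add_right_cancel h1))
  obtain rfl : v = v' := funext fun b =>
    dAlembert_injective (add_left_cancel ((h.div2_eq b).symm.trans (h'.div2_eq b)))
  exact ⟨rfl, rfl, add_left_cancel (h.eq_sum.symm.trans h'.eq_sum)⟩

theorem exists_isDecomposition (hn : 2 ≤ n) {k : Tensor2 n} (hk : IsSymm k) :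
    ∃ w v t, IsDecomposition k w v t := by
  have hn' : (1 - 1 / (n : ℝ)) ≠ 0 := by
    have : (2 : ℝ) ≤ n := by exact_mod_cast hn
    have h1 : 1 / (n : ℝ) < 1 := by rw [div_lt_iff₀] <;> linarith
    linarith
  -- Obtained by solving the identity of `IsDecomposition.div1_div2_eq` for `w`; `s` below is the
  -- scalar potential of the longitudinal part of `div2 k`.
  set w : Scalar n := (1 - 1 / (n : ℝ))⁻¹ • retardedGreen
    (retardedGreen (div1 (div2 k)) - (1 / (n : ℝ)) • trace k) with hw
  set s : Scalar n := (1 - 1 / (n : ℝ)) • dAlembert w + (1 / (n : ℝ)) • trace k with hs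
  have hs' : s = retardedGreen (div1 (div2 k)) := by
    rw [hs, hw, map_smul, dAlembert_retardedGreen, smul_inv_smul₀ hn', sub_add_cancel]
  set v : Covector n := fun b => retardedGreen (div2 k b - partialD b s) with hv
  have hdv (b : Fin n) : dAlembert (v b) = div2 k b - partialD b s := dAlembert_retardedGreen _
  have hv0 : div1 v = 0 := by
    refine dAlembert_injective ?_
    have h1 : (fun b => dAlembert (v b)) = div2 k + -fun b => partialD b s :=
      funext fun b => by rw [hdv, sub_eq_add_neg]; rfl
    rw [← div1_dAlembert, h1, div1_add, div1_neg, div1_partialD, hs', dAlembert_retardedGreen,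
      map_zero, add_neg_cancel]
  refine ⟨w, v, k - scalarPart k w - vectorPart v, hv0, fun a b => ?_, ?_, ?_, by abel⟩
  · simp only [Pi.sub_apply, hk a b, isSymm_scalarPart k w a b, isSymm_vectorPart v a b]
  · ext1 b
    rw [div2_sub, div2_sub, Pi.sub_apply, Pi.sub_apply, div2_scalarPart, div2_vectorPart, hv0, hdv,
      map_zero, Pi.zero_apply]
    abel
  · rw [trace_sub, trace_sub, trace_scalarPart, trace_vectorPart, hv0]
    simp

/-! ### Gauge fixing -/

theorem IsTransverseLongitudinal.div1_eq {X XT : Covector n} {Y : Scalar n}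
    (h : IsTransverseLongitudinal X XT Y) : div1 X = dAlembert Y := by
  have : X = XT + fun a => partialD a Y := funext h.eq_sum
  rw [this, div1_add, h.transverse, div1_partialD, zero_add]

theorem IsTransverseLongitudinal.unique {X XT XT' : Covector n} {Y Y' : Scalar n}
    (h : IsTransverseLongitudinal X XT Y) (h' : IsTransverseLongitudinal X XT' Y') :
    XT = XT' ∧ Y = Y' := by
  obtain rfl : Y = Y' := dAlembert_injective (h.div1_eq.symm.trans h'.div1_eq)
  exact ⟨funext fun a => add_right_cancel ((h.eq_sum a).symm.trans (h'.eq_sum a)), rfl⟩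

/-- Taking the divergence of the gauge condition fixes `div1 X`; with that known, the condition
itself fixes each □X_b. -/
theorem gauge_vector_unique (hn : 3 ≤ n) {h : Tensor2 n} {X X' : Covector n}
    (hX : div2 (gaugeTraceReverse h X) = 0) (hX' : div2 (gaugeTraceReverse h X') = 0) :
    X = X' := by
  have hn' : (2 - 4 / (n : ℝ)) ≠ 0 := by
    have : (3 : ℝ) ≤ n := by exact_mod_cast hn
    have h4 : 4 / (n : ℝ) < 2 := by rw [div_lt_iff₀] <;> linarith
    linarith
  have key {X : Covector n} (hX : div2 (gaugeTraceReverse h X) = 0) :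
      div1 (div2 (traceReverse h)) + (2 - 4 / (n : ℝ)) • dAlembert (div1 X) = 0 := by
    have h1 : div2 (gaugeTraceReverse h X) = div2 (traceReverse h)
        + (fun b => dAlembert (X b)) + (1 - 4 / (n : ℝ)) • fun b => partialD b (div1 X) :=
      funext (div2_gaugeTraceReverse h X)
    have h2 := congrArg div1 (h1.symm.trans hX)
    rw [div1_add, div1_add, div1_smul, div1_dAlembert, div1_partialD] at h2
    have h3 : div1 (0 : Covector n) = 0 := by simp [DeDonder.div1_eq]
    rw [← h3, ← h2]
    module
  have hd : div1 X = div1 X' := dAlembert_injective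
    (smul_right_injective _ hn' (add_left_cancel ((key hX).trans (key hX').symm)))
  ext1 b
  have h1 := (div2_gaugeTraceReverse h X b).symm.trans (congrFun (hX.trans hX'.symm) b)
  rw [div2_gaugeTraceReverse, hd] at h1
  exact dAlembert_injective (add_left_cancel (add_right_cancel h1))

/-- For X = -v + ∂Y the □v terms cancel, and what is left of the gauge condition is the gradient of
a scalar equation for □Y. -/
theorem exists_gauge_vector (hn : 3 ≤ n) {h t : Tensor2 n} {w : Scalar n} {v : Covector n}
    (hd : IsDecomposition (traceReverse h) w v t) :
    ∃ X : Covector n, div2 (gaugeTraceReverse h X) = 0 ∧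
      IsTransverseLongitudinal X (-v) (-retardedGreen
        ((((n : ℝ) - 1) / (2 * ((n : ℝ) - 2))) • dAlembert w
          + (1 / (2 * ((n : ℝ) - 2))) • trace (traceReverse h))) := by
  obtain ⟨Y, hY⟩ : ∃ Y : Scalar n, Y = -retardedGreen
      ((((n : ℝ) - 1) / (2 * ((n : ℝ) - 2))) • dAlembert w
        + (1 / (2 * ((n : ℝ) - 2))) • trace (traceReverse h)) := ⟨_, rfl⟩
  rw [← hY]
  have hn3 : (3 : ℝ) ≤ n := by exact_mod_cast hn
  have hn0 : (n : ℝ) ≠ 0 := by linarith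
  have hn2 : (n : ℝ) - 2 ≠ 0 := by linarith
  have hTL : IsTransverseLongitudinal (fun a => (-v) a + partialD a Y) (-v) Y :=
    ⟨by rw [div1_neg, hd.vector_transverse, neg_zero], fun _ => rfl⟩
  refine ⟨_, ?_, hTL⟩
  ext1 b
  -- Since 2 - 4/n = 2(n - 2)/n, multiplying turns the coefficients in `Y` into (n - 1)/n and 1/n.
  have hYd : (2 - 4 / (n : ℝ)) • dAlembert Y =
      -((1 - 1 / (n : ℝ)) • dAlembert w + (1 / (n : ℝ)) • trace (traceReverse h)) := by
    rw [hY, map_neg, dAlembert_retardedGreen, smul_neg, smul_add, smul_smul, smul_smul]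
    congr 3 <;> field_simp <;> ring
  have h1 := congrArg (partialD b) hYd
  rw [map_smul, map_neg] at h1
  rw [div2_gaugeTraceReverse, hTL.div1_eq, hd.div2_eq, map_add dAlembert, ← partialD_dAlembert,
    Pi.neg_apply, map_neg, Pi.zero_apply, ← neg_neg (partialD b (_ + _)), ← h1]
  module

/-- The double divergence also vanishes, which kills the longitudinal potential and leaves □v = 0.
-/
theorem IsDecomposition.vector_eq_zero {k t : Tensor2 n} {w : Scalar n} {v : Covector n}
    (h : IsDecomposition k w v t) (hk : div2 k = 0) : v = 0 := by
  have h1 := h.div1_div2_eq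
  have h3 : div1 (0 : Covector n) = dAlembert 0 := by simp [DeDonder.div1_eq]
  rw [hk, h3] at h1
  ext1 b
  have h2 := h.div2_eq b
  rw [← dAlembert_injective h1, hk, map_zero, zero_add] at h2
  exact dAlembert_injective (by rw [← h2]; simp)

end DeDonder

end

theorem mainTheorem6 (n : ℕ) [NeZero n] (hn : 3 ≤ n) :
    (∃! G : DeDonder.Scalar n →ₗ[ℝ] DeDonder.Scalar n, DeDonder.IsRetardedGreen G) ∧
    (∀ k : DeDonder.Tensor2 n, DeDonder.IsSymm k →
      ∃! p : DeDonder.Scalar n × DeDonder.Covector n × DeDonder.Tensor2 n,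
        DeDonder.IsDecomposition k p.1 p.2.1 p.2.2) ∧
    ∀ h : DeDonder.Tensor2 n, DeDonder.IsSymm h →
      ∃ X : DeDonder.Covector n,
        DeDonder.div2 (DeDonder.gaugeTraceReverse h X) = 0 ∧
        (∀ X' : DeDonder.Covector n,
          DeDonder.div2 (DeDonder.gaugeTraceReverse h X') = 0 → X' = X) ∧
        (∀ (G : DeDonder.Scalar n →ₗ[ℝ] DeDonder.Scalar n)
          (w : DeDonder.Scalar n) (v : DeDonder.Covector n) (t : DeDonder.Tensor2 n),
          DeDonder.IsRetardedGreen G →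
          DeDonder.IsDecomposition (DeDonder.traceReverse h) w v t →
          ∀ (XT : DeDonder.Covector n) (Y : DeDonder.Scalar n),
            DeDonder.IsTransverseLongitudinal X XT Y ↔
              XT = -v ∧
              Y = -G ((((n : ℝ) - 1) / (2 * ((n : ℝ) - 2))) • DeDonder.dAlembert w
                + (1 / (2 * ((n : ℝ) - 2))) • DeDonder.trace (DeDonder.traceReverse h))) ∧
        (∀ (w' : DeDonder.Scalar n) (v' : DeDonder.Covector n) (t' : DeDonder.Tensor2 n),
          DeDonder.IsDecomposition (DeDonder.gaugeTraceReverse h X) w' v' t' →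
          v' = 0 ∧ DeDonder.vectorPart v' = 0) := by
  have hn2 : 2 ≤ n := by omega
  refine ⟨⟨_, DeDonder.isRetardedGreen_retardedGreen, fun G hG => hG.eq⟩, fun k hk => ?_,
    fun h hh => ?_⟩
  · obtain ⟨w, v, t, hd⟩ := DeDonder.exists_isDecomposition hn2 hk
    refine ⟨(w, v, t), hd, ?_⟩
    rintro ⟨w', v', t'⟩ hd'
    obtain ⟨rfl, rfl, rfl⟩ := hd.unique hn2 hd'
    rfl
  · obtain ⟨w, v, t, hd⟩ :=
      DeDonder.exists_isDecomposition hn2 (DeDonder.isSymm_traceReverse hh)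
    obtain ⟨X, hX, hTL⟩ := DeDonder.exists_gauge_vector hn hd
    refine ⟨X, hX, fun X' hX' => DeDonder.gauge_vector_unique hn hX' hX, ?_, ?_⟩
    · intro G w' v' t' hG hd' XT Y
      -- Uniqueness of the decomposition and of the Green operator identifies the arbitrary data
      -- with those used to construct `X`.
      obtain ⟨rfl, rfl, rfl⟩ := hd.unique hn2 hd'
      rw [hG.eq]
      exact ⟨fun hTL' => hTL'.unique hTL, by rintro ⟨rfl, rfl⟩; exact hTL⟩
    · intro w' v' t' hd'
      obtain rfl := hd'.vector_eq_zero hX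
      refine ⟨rfl, ?_⟩
      ext1 a
      ext1 b
      simp [DeDonder.vectorPart]
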